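/- A simple graph on $n\ge 3$ vertices is called pancyclic if it contains a cycle of length $\ell$ for every integer $\ell$ with $3\le \ell\le n$. Let $m(n)$ be the minimum number of edges of a pancyclic graph on $n$ vertices. Then for $3\le n\le 37$ the exact value is $m(n)=n+k$, where $$k=\begin{cases}0, & n=3,\\ 1, & 4\le n\le 5,\\ 2, & 6\le n\le 8,\\ 3, & 9\le n\le 14,\\ 4, & 15\le n\le 24,\\ 5, & 25\le n\le 37.\end{cases}$$ Moreover, for every $21\le n\le 37$ the graph on the vertices $0,1,\dots,n-1$ that consists of the cycle $0,1,\dots,n-1,0$ and the five chords $\{0,2\}$, $\{1,7\}$, $\{3,6\}$, $\{4,12\}$, $\{8,21\}$ (where, for $n=21$, the vertex $21$ is read as $0$) is pancyclic and has exactly $n+5$ edges. -/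

import Mathlib

/-- A finite simple graph on `n` vertices is pancyclic if it has a cycle of every length `ℓ`
with `3 ≤ ℓ ≤ n`. -/
def IsPancyclic {V : Type*} [Fintype V] (G : SimpleGraph V) : Prop :=
  ∀ ℓ : ℕ, 3 ≤ ℓ → ℓ ≤ Fintype.card V →
    ∃ (v : V) (p : G.Walk v v), p.IsCycle ∧ p.length = ℓ

/-- `m(n)`: the minimum number of edges of a pancyclic graph on `n` vertices.
The complete graph is pancyclic, so this is the infimum of a nonempty set of natural
numbers, hence a minimum. -/
noncomputable def minPancyclicEdges (n : ℕ) : ℕ :=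
  sInf {e : ℕ | ∃ G : SimpleGraph (Fin n), IsPancyclic G ∧ G.edgeSet.ncard = e}

/-- The construction with five chords: the cycle `0, 1, …, n - 1` together with the chords
`{0, 2}`, `{1, 7}`, `{3, 6}`, `{4, 12}`, `{8, 21}`. It is meant for `n ≥ 21`; the path from
vertex `21` on to vertex `0` has `x = n - 21` edges, so that `21` is read as `0` for `n = 21`. -/
def fiveChordGraph (n : ℕ) : SimpleGraph (Fin n) :=
  SimpleGraph.fromRel fun u v =>
    (v : ℕ) = ((u : ℕ) + 1) % n ∨
      ((u : ℕ), (v : ℕ)) ∈ [(0, 2), (1, 7), (3, 6), (4, 12), (8, 21 % n)]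

/-!
Number the vertices along a Hamiltonian cycle, the ring, so that a graph with `n` vertices and
`n + k` edges is the ring together with `k` chords, whose ends divide the ring into at most `2 k`
gaps. A cycle other than the ring is determined by the chords that it uses and by a single bit: it
uses each gap completely or not at all, and since it has an even number of edges at each vertex,
it switches between using and avoiding the gaps exactly at the ends of its chords. Hence the length
of the cycle is its number of chords plus the lengths of certain gaps.

For each of the finitely many ways to join the ends by `k` chords, this gives a list of forms in the
unknown lengths of the gaps, whose values have to include all the numbers from `3` to `n - 1`. This
bounds `n`, and for each `n` within the bound a search settles whether there are suitable lengths: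
the form that has the smallest missing length is chosen in all possible ways, its gaps are given
lengths, and a branch is abandoned once more forms have repeated a length than there are forms in
excess of the lengths.

For the upper bound, cycles of all lengths are found in explicit graphs.
-/

namespace Pancyclic

open Finset

/-! ### The search -/

/-- Whether the binary digit of `s` at position `x` is one. Binary digits encode finite sets of
natural numbers; this definition and those below call the arithmetic functions of `Nat` directly,
because the kernel then evaluates the search without unfolding any instances. -/
def hasDigit (s x : ℕ) : Bool := Nat.beq (Nat.land (Nat.shiftRight s x) 1) 1

/-- The value `k x`, where the recursion makes the kernel evaluate `x` before it is substituted
into `k`. -/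
def force (x : ℕ) (k : ℕ → Bool) : Bool := Nat.rec (k 0) (fun m _ => k (Nat.succ m)) x

/-- The first number from `a` on that satisfies `p`, or `a + k` if there is none below it. -/
def first (p : ℕ → Bool) : ℕ → ℕ → ℕ
  | 0, a => a
  | k + 1, a => bif p a then a else first p k (Nat.succ a)

/-- The length of a cycle, as far as it is known: `(c, s)` stands for `c` plus the lengths of the
unknown gaps in the set `s` encoded in binary. -/
abbrev Form := ℕ × ℕ

/-- The gaps in the set encoded by `s`. -/
def gaps (s : ℕ) : Finset ℕ := {r ∈ range s | hasDigit s r}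

/-- The length that a form stands for when `g` gives the lengths of the gaps. -/
def eval (g : ℕ → ℕ) (f : Form) : ℕ := f.1 + ∑ r ∈ gaps f.2, g r

/-- Pass to `next` the form that results from `f` when the gap `r` gets the length `v`. -/
def assign (r v : ℕ) (f : Form) (next : Form → Bool) : Bool :=
  bif hasDigit f.2 r then
    force (Nat.add f.1 v) fun c => force (Nat.xor f.2 (Nat.pow 2 r)) fun s => next (c, s)
  else next f

/-- The rest of a search: it is given the forms with unknown gaps, the set of the known cycle
lengths and the number of cycles that may still be wasted, and it returns `false` if these data
are contradictory. -/
abbrev Search := List Form → ℕ → ℕ → Bool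

/-- Enter a known cycle length `x`. A length that is already known costs one cycle. -/
def record (x : ℕ) (next : Search) : Search := fun live found slack =>
  bif hasDigit found x then
    bif Nat.beq slack 0 then false else next live found (Nat.pred slack)
  else next live (Nat.lor found (Nat.pow 2 x)) slack

/-- Enter a form; `t` is the form of the Hamiltonian cycle, of length `n`, which determines each
form with all the unknown gaps. -/
def enter (n : ℕ) (t f : Form) (next : Search) : Search := fun live found slack =>
  bif Nat.beq f.2 0 then record f.1 next live found slack
  else bif Nat.beq f.2 t.2 then record (Nat.add f.1 (Nat.sub n t.1)) next live found slack
  else next (f :: live) found slack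

/-- Give the gap `r` the length `v` in all the forms `fs`. -/
def assignAll (n r v : ℕ) (t : Form) (fs : List Form) (next : Search) : Search :=
  fs.foldr (fun f next live found slack =>
    assign r v f fun f => enter n t f next live found slack) next

/-- The possible lengths of the unknown gap `r` of a form `f` that is to have the length `ℓ`. -/
def candidates (ℓ : ℕ) (f : Form) (r : ℕ) : List ℕ :=
  bif Nat.beq f.2 (Nat.pow 2 r) then [Nat.sub ℓ f.1]
  else List.range' 1 (Nat.pred (Nat.sub ℓ f.1))

/-- Search for lengths of the gaps, the form `f` having the length `ℓ`: fix the first unknown gap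
of `f` in all possible ways, or if there is none, let each form in turn have the smallest length
that is still missing. The search gives up, with the answer `true`, when `fuel` runs out. -/
def search (n : ℕ) : ℕ → ℕ → Form → Form → Search
  | 0, _, _, _, _, _, _ => true
  | fuel + 1, ℓ, t, f, live, found, slack =>
    bif Nat.beq f.2 0 then
      force (first (fun x => !hasDigit found x) n ℓ) fun ℓ =>
        bif Nat.ble n ℓ then true
        else live.any fun f => search n fuel ℓ t f live found slack
    else bif Nat.ble ℓ f.1 then false
    else
      force (first (hasDigit f.2) f.2 0) fun r =>
        (candidates ℓ f r).any fun v => assign r v t fun t => assign r v f fun f =>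
          assignAll n r v t live (search n fuel ℓ t f) [] found slack

/-- The set of the gaps between the two ends of a chord. The ends of the chords are numbered around
the ring, the gap `r` follows the end `r`, and a chord is given as the pair of the numbers of its
ends. -/
def arc (e : ℕ × ℕ) : ℕ := Nat.xor (Nat.pred (Nat.pow 2 e.1)) (Nat.pred (Nat.pow 2 e.2))

/-- One of the two sets of gaps, selected by `b`, that a cycle can use when its chords are those
of `T`: at each of their ends it changes between using and avoiding the gaps. There are `N` gaps. -/
def usedGaps (N : ℕ) (b : Bool) (T : List (ℕ × ℕ)) : ℕ :=
  T.foldr (fun e s => Nat.xor (arc e) s) (bif b then Nat.pred (Nat.pow 2 N) else 0)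

/-- Whether the set encoded by `t` is a subset of the one encoded by `s`. -/
def includes (s t : ℕ) : Bool := Nat.beq (Nat.land s t) t

/-- Whether both gaps next to the end `i` belong to the set `s`. -/
def passes (N s i : ℕ) : Bool := hasDigit s i && hasDigit s (Nat.mod (Nat.pred (Nat.add i N)) N)

/-- A necessary condition for a cycle with the chords `T` and the gaps `s` to exist: it has only
two edges at each end of a chord of `T`, and if it contains all the gaps on one side of such a
chord, then it has no other chord. -/
def admissible (N : ℕ) (T : List (ℕ × ℕ)) (s : ℕ) : Bool :=
  T.all fun e => !passes N s e.1 && !passes N s e.2 &&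
    (Nat.beq T.length 1 ||
      !includes s (arc e) && !includes s (Nat.xor (Nat.pred (Nat.pow 2 N)) (arc e)))

/-- The forms of the possible cycles that use at least one of the chords `C`. -/
def forms (N : ℕ) (C : List (ℕ × ℕ)) : List Form :=
  C.sublists.flatMap fun T =>
    bif T.isEmpty then [] else
      [false, true].flatMap fun b =>
        bif admissible N T (usedGaps N b T) then [(T.length, usedGaps N b T)] else []

/-- The chords between `N` ends, apart from `(0, s)`, that span at least `s` gaps on each side. -/
def pairs (N s : ℕ) : List (ℕ × ℕ) :=
  ((List.range N).flatMap fun i => (List.range N).map fun j => (i, j)).filter fun e =>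
    Nat.ble (Nat.add e.1 s) e.2 && Nat.ble (Nat.add e.2 s) (Nat.add e.1 N) &&
      !(Nat.beq e.1 0 && Nat.beq e.2 s)

/-- Whether each of the `N` ends is an end of one of the chords `C`. -/
def covers (N : ℕ) (C : List (ℕ × ℕ)) : Bool :=
  Nat.beq (Nat.pred (Nat.pow 2 N))
    (C.foldr (fun e s => Nat.lor (Nat.pow 2 e.1) (Nat.lor (Nat.pow 2 e.2) s)) 0)

/-- The systems of `k` chords with `N` ends, each of them started at an end of a chord that spans
as few gaps as possible. -/
def diagrams (k N : ℕ) : List (List (ℕ × ℕ)) :=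
  (List.range N).flatMap fun s => bif Nat.beq s 0 then [] else
    (((pairs N s).sublistsLen (Nat.pred k)).map fun C => (0, s) :: C).filter (covers N)

/-- Whether the search shows that `F`, the list of the forms of the cycles other than the ring,
does not realize all the lengths from `3` to `n - 1` for any number `n ≥ n₀` of vertices. Since `F`
must have at least `n - 3` members, only finitely many `n` have to be tried; `s` is the number of
the members in excess. -/
def refuted (N n₀ : ℕ) (F : List Form) : Bool :=
  (List.range (Nat.sub (Nat.add F.length 4) n₀)).all fun s =>
    force (Nat.sub (Nat.add F.length 3) s) fun n =>
      !search n 100 3 (0, Nat.pred (Nat.pow 2 N)) (0, 0) F 0 s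

/-! ### Soundness of the search -/

theorem hasDigit_eq_testBit (s x : ℕ) : hasDigit s x = s.testBit x := by
  rw [Bool.eq_iff_iff, hasDigit, Nat.beq_eq, Nat.testBit_eq_decide_div_mod_eq, decide_eq_true_iff,
    ← Nat.shiftRight_eq_div_pow, ← Nat.and_one_is_mod]
  rfl

theorem hasDigit_xor (s t x : ℕ) :
    hasDigit (Nat.xor s t) x = (hasDigit s x ^^ hasDigit t x) := by
  simp only [hasDigit_eq_testBit]
  exact Nat.testBit_xor s t x

theorem hasDigit_two_pow (r x : ℕ) : hasDigit (Nat.pow 2 r) x = decide (r = x) := by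
  simp only [hasDigit_eq_testBit]
  exact Nat.testBit_two_pow

theorem hasDigit_lor (s t x : ℕ) :
    hasDigit (Nat.lor s t) x = (hasDigit s x || hasDigit t x) := by
  simp only [hasDigit_eq_testBit]
  exact Nat.testBit_or s t x

theorem force_eq (x : ℕ) (k : ℕ → Bool) : force x k = k x := by
  cases x <;> rfl

theorem le_first (p : ℕ → Bool) (k a : ℕ) : a ≤ first p k a := by
  induction k generalizing a with
  | zero => rfl
  | succ k ih =>
    rw [first]
    cases p a
    · exact (Nat.le_succ a).trans (ih _)
    · rfl

theorem apply_first {p : ℕ → Bool} {k a x : ℕ} (hx : p x) (hax : a ≤ x) (hxk : x < a + k) :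
    p (first p k a) := by
  induction k generalizing a with
  | zero => omega
  | succ k ih =>
    rw [first]
    cases ha : p a
    · have : a ≠ x := by rintro rfl; simp_all
      exact ih (by omega) (by omega)
    · exact ha

theorem apply_first_of_lt {p : ℕ → Bool} {k a : ℕ} (h : first p k a < a + k) :
    p (first p k a) := by
  induction k generalizing a with
  | zero => exact absurd h (lt_irrefl a)
  | succ k ih =>
    rw [first] at h ⊢
    cases ha : p a
    · rw [ha] at h
      exact ih (by rw [cond_false] at h; omega)
    · exact ha

theorem mem_gaps {r s : ℕ} : r ∈ gaps s ↔ hasDigit s r := by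
  rw [gaps, mem_filter, mem_range, hasDigit_eq_testBit, and_iff_right_iff_imp]
  exact fun h => r.lt_two_pow_self.trans_le (Nat.ge_two_pow_of_testBit h)

theorem gaps_nonempty {s : ℕ} (hs : s ≠ 0) : (gaps s).Nonempty := by
  obtain ⟨r, hr⟩ := Nat.exists_testBit_of_ne_zero hs
  exact ⟨r, mem_gaps.2 (hasDigit_eq_testBit s r ▸ hr)⟩

theorem gaps_xor_two_pow {r s : ℕ} (hr : r ∈ gaps s) :
    gaps (Nat.xor s (Nat.pow 2 r)) = (gaps s).erase r := by
  ext x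
  rw [mem_gaps, mem_erase, mem_gaps, hasDigit_xor, hasDigit_two_pow]
  by_cases h : r = x
  · simp [h, mem_gaps.1 (h ▸ hr)]
  · simp [h, Ne.symm h]

section Soundness

variable {g : ℕ → ℕ}

theorem eval_of_snd_eq_zero {f : Form} (h : f.2 = 0) : eval g f = f.1 := by
  simp [eval, h, gaps]

theorem fst_lt_eval (hg : ∀ r, 0 < g r) {f : Form} (h : f.2 ≠ 0) : f.1 < eval g f :=
  Nat.lt_add_of_pos_right (sum_pos (fun r _ => hg r) (gaps_nonempty h))

theorem eval_assigned {f : Form} {r : ℕ} (hr : r ∈ gaps f.2) :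
    eval g (Nat.add f.1 (g r), Nat.xor f.2 (Nat.pow 2 r)) = eval g f := by
  simp only [eval, gaps_xor_two_pow hr, ← add_sum_erase _ g hr]
  exact add_assoc ..

theorem assign_sound {f : Form} {r : ℕ} {next : Form → Bool}
    (hnext : ∀ f', eval g f' = eval g f → next f') : assign r (g r) f next := by
  rw [assign]
  cases hr : hasDigit f.2 r
  · exact hnext f rfl
  · simp only [cond_true, force_eq]
    exact hnext _ (eval_assigned (mem_gaps.2 hr))

/-- The data of a search are consistent with the lengths `g` of the gaps: there are `n` vertices,
each length from `3` to `n - 1` is known to be the length of a cycle or is the length of a live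
form, and the slack accounts for the live forms in excess of the missing lengths. -/
structure Consistent (n : ℕ) (g : ℕ → ℕ) (t : Form) (live : List Form) (found slack : ℕ) :
    Prop where
  eval_total : eval g t = n
  covers : ∀ ℓ ∈ Ico 3 n, hasDigit found ℓ = false → ∃ f ∈ live, eval g f = ℓ
  length_le : live.length ≤ #{ℓ ∈ Ico 3 n | hasDigit found ℓ = false} + slack

/-- A search `next` never returns `false` on data that are consistent with `g`, the forms `fs`
being added to the live ones. -/
def Sound (n : ℕ) (g : ℕ → ℕ) (t : Form) (fs : List Form) (next : Search) : Prop :=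
  ∀ live found slack, Consistent n g t (fs ++ live) found slack → next live found slack

variable {n x found slack : ℕ} {t f : Form} {fs live : List Form} {next : Search}

theorem card_le_length_of_covers {L : Finset ℕ} (h : ∀ ℓ ∈ L, ∃ f ∈ live, eval g f = ℓ) :
    #L ≤ live.length := by
  have hL : L ⊆ (live.map (eval g)).toFinset := fun ℓ hℓ => by simpa using h ℓ hℓ
  simpa using (card_le_card hL).trans (List.toFinset_card_le _)

theorem Consistent.perm (h : Consistent n g t live found slack) (hp : live.Perm fs) :
    Consistent n g t fs found slack where
  eval_total := h.eval_total
  covers ℓ hℓ hfound := by simpa only [hp.mem_iff] using h.covers ℓ hℓ hfound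
  length_le := hp.length_eq ▸ h.length_le

theorem Consistent.congr_head {f' : Form} (h : Consistent n g t (f :: fs) found slack)
    (hf : eval g f' = eval g f) : Consistent n g t (f' :: fs) found slack where
  eval_total := h.eval_total
  covers ℓ hℓ hfound := by simpa [hf] using h.covers ℓ hℓ hfound
  length_le := h.length_le

theorem Consistent.record_known (h : Consistent n g t (f :: fs) found slack)
    (hx : hasDigit found (eval g f)) :
    slack ≠ 0 ∧ Consistent n g t fs found (slack - 1) := by
  have hcovers : ∀ ℓ ∈ Ico 3 n, hasDigit found ℓ = false → ∃ f ∈ fs, eval g f = ℓ := by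
    intro ℓ hℓ hfound
    obtain ⟨f', hf', rfl⟩ := h.covers ℓ hℓ hfound
    obtain rfl | hf' := List.mem_cons.1 hf'
    · simp [hx] at hfound
    · exact ⟨f', hf', rfl⟩
  have hcard : #{ℓ ∈ Ico 3 n | hasDigit found ℓ = false} ≤ fs.length :=
    card_le_length_of_covers fun ℓ hℓ => hcovers ℓ (mem_filter.1 hℓ).1 (mem_filter.1 hℓ).2
  have hlength := h.length_le
  rw [List.length_cons] at hlength
  exact ⟨by omega, h.eval_total, hcovers, by omega⟩

theorem Consistent.record_new (h : Consistent n g t (f :: fs) found slack) :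
    Consistent n g t fs (Nat.lor found (Nat.pow 2 (eval g f))) slack where
  eval_total := h.eval_total
  covers ℓ hℓ hfound := by
    simp only [hasDigit_lor, hasDigit_two_pow, Bool.or_eq_false_iff, decide_eq_false_iff_not]
      at hfound
    obtain ⟨f', hf', rfl⟩ := h.covers ℓ hℓ hfound.1
    obtain rfl | hf' := List.mem_cons.1 hf'
    · exact absurd rfl hfound.2
    · exact ⟨f', hf', rfl⟩
  length_le := by
    have herase : {ℓ ∈ Ico 3 n | hasDigit (Nat.lor found (Nat.pow 2 (eval g f))) ℓ = false} =
        {ℓ ∈ Ico 3 n | hasDigit found ℓ = false}.erase (eval g f) := by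
      ext ℓ
      simp only [hasDigit_lor, hasDigit_two_pow, Bool.or_eq_false_iff, decide_eq_false_iff_not,
        mem_filter, mem_erase]
      tauto
    have hlength := h.length_le
    have hpred := pred_card_le_card_erase (s := {ℓ ∈ Ico 3 n | hasDigit found ℓ = false})
      (a := eval g f)
    rw [List.length_cons] at hlength
    rw [herase]
    omega

theorem record_sound (h : Consistent n g t (f :: (fs ++ live)) found slack)
    (hx : eval g f = x) (hnext : Sound n g t fs next) : record x next live found slack := by
  subst hx
  rw [record]
  cases hx : hasDigit found (eval g f)
  · exact hnext _ _ _ h.record_new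
  · obtain ⟨hslack, hrest⟩ := h.record_known hx
    cases hzero : Nat.beq slack 0
    · exact hnext _ _ _ hrest
    · exact absurd (Nat.eq_of_beq_eq_true hzero) hslack

theorem enter_sound (h : Consistent n g t (f :: (fs ++ live)) found slack)
    (hnext : Sound n g t fs next) : enter n t f next live found slack := by
  rw [enter]
  cases hzero : Nat.beq f.2 0
  · cases htotal : Nat.beq f.2 t.2
    · exact hnext _ _ _ (h.perm List.perm_middle.symm)
    · refine record_sound h ?_ hnext
      rw [← h.eval_total, eval, eval, Nat.eq_of_beq_eq_true htotal]
      exact congrArg _ (Nat.add_sub_cancel_left ..).symm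
  · exact record_sound h (eval_of_snd_eq_zero (Nat.eq_of_beq_eq_true hzero)) hnext

theorem assignAll_sound (r : ℕ) (hnext : Sound n g t [] next) :
    Sound n g t fs (assignAll n r (g r) t fs next) := by
  induction fs with
  | nil => exact hnext
  | cons f fs ih =>
    exact fun live found slack h => assign_sound fun f' hf' => enter_sound (h.congr_head hf') ih

theorem first_mem_gaps {s : ℕ} (hs : s ≠ 0) : first (hasDigit s) s 0 ∈ gaps s := by
  obtain ⟨r, hr⟩ := gaps_nonempty hs
  rw [gaps, mem_filter, mem_range] at hr
  exact mem_gaps.2 (apply_first hr.2 (Nat.zero_le r) (by omega))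

theorem mem_candidates (hg : ∀ r, 0 < g r) {ℓ r : ℕ} (hr : r ∈ gaps f.2) (hf : eval g f = ℓ) :
    g r ∈ candidates ℓ f r := by
  have heval := (eval_assigned hr).trans hf
  rw [candidates]
  cases hlast : Nat.beq f.2 (Nat.pow 2 r)
  · have hne : Nat.xor f.2 (Nat.pow 2 r) ≠ 0 := fun h =>
      Nat.ne_of_beq_eq_false hlast (Nat.xor_eq_zero_iff.1 h)
    have hlt : f.1 + g r < ℓ := (fst_lt_eval hg hne).trans_eq heval
    have hsub : (ℓ.sub f.1).pred = ℓ - f.1 - 1 := rfl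
    have := hg r
    rw [cond_false, List.mem_range'_1]
    omega
  · have hzero : Nat.xor f.2 (Nat.pow 2 r) = 0 :=
      Nat.xor_eq_zero_iff.2 (Nat.eq_of_beq_eq_true hlast)
    rw [eval_of_snd_eq_zero hzero] at heval
    exact List.mem_singleton.2 (Nat.eq_sub_of_add_eq' heval)

theorem search_sound (hg : ∀ r, 0 < g r) {fuel ℓ : ℕ} (hℓ : 3 ≤ ℓ)
    (hf : f.2 ≠ 0 → eval g f = ℓ) : Sound n g t [] (search n fuel ℓ t f) := by
  induction fuel generalizing ℓ t f with
  | zero => exact fun _ _ _ _ => rfl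
  | succ fuel ih =>
    intro live found slack h
    rw [search]
    cases hs : Nat.beq f.2 0
    · have hs : f.2 ≠ 0 := Nat.ne_of_beq_eq_false hs
      have hble : Nat.ble ℓ f.1 = false := by
        rw [Bool.eq_false_iff, Ne, Nat.ble_eq, not_le, ← hf hs]
        exact fst_lt_eval hg hs
      rw [cond_false, hble, cond_false, force_eq]
      refine List.any_eq_true.2 ⟨_, mem_candidates hg (first_mem_gaps hs) (hf hs), ?_⟩
      refine assign_sound fun t' ht' => assign_sound fun f' hf' => ?_
      exact assignAll_sound _ (ih hℓ fun _ => hf'.trans (hf hs)) _ _ _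
        { (h.perm (.of_eq (List.append_nil live).symm)) with
          eval_total := ht'.trans h.eval_total }
    · rw [cond_true, force_eq]
      have hle := le_first (fun x => !hasDigit found x) n ℓ
      have hfirst := apply_first_of_lt (p := fun x => !hasDigit found x) (k := n) (a := ℓ)
      generalize first (fun x => !hasDigit found x) n ℓ = ℓ' at hle hfirst ⊢
      cases hn : Nat.ble n ℓ'
      · have hlt : ℓ' < n := by simpa [Bool.eq_false_iff, Nat.ble_eq] using hn
        obtain ⟨f', hf', heval⟩ := h.covers ℓ' (mem_Ico.2 ⟨hℓ.trans hle, hlt⟩)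
          (by simpa using hfirst (by omega))
        exact List.any_eq_true.2 ⟨f', hf', ih (hℓ.trans hle) (fun _ => heval) _ _ _ h⟩
      · rfl

end Soundness

theorem hasDigit_zero (x : ℕ) : hasDigit 0 x = false := by
  rw [hasDigit_eq_testBit, Nat.zero_testBit]

theorem hasDigit_pred_two_pow (N r : ℕ) :
    hasDigit (Nat.pred (Nat.pow 2 N)) r = decide (r < N) := by
  rw [hasDigit_eq_testBit]
  exact Nat.testBit_two_pow_sub_one N r

theorem hasDigit_arc (e : ℕ × ℕ) (r : ℕ) :
    hasDigit (arc e) r = (decide (r < e.1) ^^ decide (r < e.2)) := by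
  rw [arc, hasDigit_xor, hasDigit_pred_two_pow, hasDigit_pred_two_pow]

theorem gaps_pred_two_pow (N : ℕ) : gaps (Nat.pred (Nat.pow 2 N)) = range N := by
  ext r
  rw [mem_gaps, hasDigit_pred_two_pow, decide_eq_true_iff, mem_range]

theorem lt_of_refuted {N n n₀ : ℕ} {F : List Form} (hF : refuted N n₀ F) {g : ℕ → ℕ}
    (hg : ∀ r, 0 < g r) (hsum : ∑ r ∈ range N, g r = n)
    (hcovers : ∀ ℓ ∈ Ico 3 n, ∃ f ∈ F, eval g f = ℓ) : n < n₀ := by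
  by_contra! hn
  have hlength := card_le_length_of_covers hcovers
  rw [Nat.card_Ico] at hlength
  have hmem : F.length + 3 - n ∈ List.range (Nat.sub (Nat.add F.length 4) n₀) :=
    List.mem_range.2 (by change _ < F.length + 4 - n₀; omega)
  have hforce := List.all_eq_true.1 hF _ hmem
  have hn' : Nat.sub (Nat.add F.length 3) (F.length + 3 - n) = n := by
    change F.length + 3 - (F.length + 3 - n) = n
    omega
  rw [force_eq, hn'] at hforce
  refine absurd (search_sound hg le_rfl (fun h => (h rfl).elim) F 0 _ ⟨?_, ?_, ?_⟩)
    (Bool.eq_false_iff.1 ((Bool.not_eq_eq_eq_not ..).mp hforce))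
  · rw [eval, gaps_pred_two_pow, hsum, zero_add]
  · exact fun ℓ hℓ _ => hcovers ℓ hℓ
  · simp only [hasDigit_zero, filter_true, Nat.card_Ico, List.nil_append]
    omega

theorem includes_iff {s t : ℕ} : includes s t ↔ ∀ r, hasDigit t r → hasDigit s r := by
  have hland : includes s t ↔ ∀ r, (s.testBit r && t.testBit r) = t.testBit r := by
    simp only [includes, Nat.beq_eq, ← Nat.testBit_and]
    exact ⟨fun h r => congrArg (Nat.testBit · r) h, Nat.eq_of_testBit_eq⟩
  simp only [hland, hasDigit_eq_testBit, Bool.and_eq_right_iff_imp]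

section UsedGaps

variable {N : ℕ} {T : List (ℕ × ℕ)}

theorem hasDigit_usedGaps_nil (b : Bool) (r : ℕ) :
    hasDigit (usedGaps N b []) r = (b && decide (r < N)) := by
  cases b
  · exact hasDigit_zero r
  · exact hasDigit_pred_two_pow N r

theorem hasDigit_usedGaps_cons (b : Bool) (e : ℕ × ℕ) (r : ℕ) :
    hasDigit (usedGaps N b (e :: T)) r = (hasDigit (arc e) r ^^ hasDigit (usedGaps N b T) r) :=
  hasDigit_xor _ _ r

theorem hasDigit_usedGaps_not (b : Bool) {r : ℕ} (hr : r < N) :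
    hasDigit (usedGaps N (!b) T) r = !hasDigit (usedGaps N b T) r := by
  induction T with
  | nil => simp [hasDigit_usedGaps_nil, hr]
  | cons e T ih => rw [hasDigit_usedGaps_cons, hasDigit_usedGaps_cons, ih, Bool.xor_not]

theorem hasDigit_usedGaps_of_le (hT : ∀ e ∈ T, e.1 < e.2 ∧ e.2 < N) (b : Bool) {r : ℕ}
    (hr : N ≤ r) : hasDigit (usedGaps N b T) r = false := by
  induction T with
  | nil => simp [hasDigit_usedGaps_nil, hr]
  | cons e T ih =>
    obtain ⟨he, hT⟩ := List.forall_mem_cons.1 hT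
    rw [hasDigit_usedGaps_cons, ih hT, hasDigit_arc, decide_eq_false (by omega),
      decide_eq_false (by omega)]
    rfl

theorem hasDigit_arc_add_one {e : ℕ × ℕ} (he : e.1 < e.2) (r : ℕ) :
    hasDigit (arc e) (r + 1) =
      (hasDigit (arc e) r ^^ decide (e.1 = r + 1 ∨ e.2 = r + 1)) := by
  rw [hasDigit_arc, hasDigit_arc]
  grind

theorem hasDigit_usedGaps_add_one (hT : ∀ e ∈ T, e.1 < e.2 ∧ e.2 < N) (b : Bool) {r : ℕ}
    (hr : r + 1 < N) :
    hasDigit (usedGaps N b T) (r + 1) = (hasDigit (usedGaps N b T) r ^^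
      decide (Odd (T.countP fun e => e.1 = r + 1 ∨ e.2 = r + 1))) := by
  induction T with
  | nil => simp [hasDigit_usedGaps_nil, hr, Nat.lt_of_succ_lt hr]
  | cons e T ih =>
    obtain ⟨he, hT⟩ := List.forall_mem_cons.1 hT
    rw [hasDigit_usedGaps_cons, hasDigit_usedGaps_cons, ih hT, hasDigit_arc_add_one he.1,
      List.countP_cons]
    by_cases hr : e.1 = r + 1 ∨ e.2 = r + 1
    · simp only [hr, decide_true, if_true, Nat.odd_add_one, decide_not]
      grind
    · simp only [hr, decide_false, Bool.xor_false, Bool.false_eq_true, if_false, add_zero,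
        Bool.xor_assoc]

theorem exists_hasDigit_usedGaps_eq (hT : ∀ e ∈ T, e.1 < e.2 ∧ e.2 < N) (hN : 0 < N) {u : ℕ → Bool}
    (hu : ∀ r, r + 1 < N →
      u (r + 1) = (u r ^^ decide (Odd (T.countP fun e => e.1 = r + 1 ∨ e.2 = r + 1)))) :
    ∃ b, ∀ r, hasDigit (usedGaps N b T) r = (decide (r < N) && u r) := by
  obtain ⟨b, hb⟩ : ∃ b, hasDigit (usedGaps N b T) 0 = u 0 := by
    by_cases h : hasDigit (usedGaps N false T) 0 = u 0
    · exact ⟨false, h⟩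
    · exact ⟨true, (hasDigit_usedGaps_not false hN).trans (Bool.not_eq.2 h)⟩
  refine ⟨b, fun r => ?_⟩
  obtain hr | hr := le_or_gt N r
  · rw [hasDigit_usedGaps_of_le hT b hr, decide_eq_false hr.not_gt, Bool.false_and]
  · rw [decide_eq_true hr, Bool.true_and]
    induction r with
    | zero => exact hb
    | succ r ih => rw [hasDigit_usedGaps_add_one hT b hr, ih (Nat.lt_of_succ_lt hr), hu r hr]

end UsedGaps

theorem mem_forms {N : ℕ} {C T : List (ℕ × ℕ)} {b : Bool} (hTC : T.Sublist C) (hT : T ≠ [])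
    (hadm : admissible N T (usedGaps N b T)) : (T.length, usedGaps N b T) ∈ forms N C := by
  refine List.mem_flatMap.2 ⟨T, List.mem_sublists.2 hTC, ?_⟩
  rw [List.isEmpty_eq_false_iff.2 hT, cond_false]
  refine List.mem_flatMap.2 ⟨b, by cases b <;> simp, ?_⟩
  rw [hadm]
  exact List.mem_singleton_self _

theorem eq_of_hasDigit_eq {s t : ℕ} (h : ∀ r, hasDigit s r = hasDigit t r) : s = t :=
  Nat.eq_of_testBit_eq fun r => by simpa only [hasDigit_eq_testBit] using h r

theorem covers_of_forall {N : ℕ} {C : List (ℕ × ℕ)}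
    (h : ∀ i, i < N ↔ ∃ e ∈ C, e.1 = i ∨ e.2 = i) : covers N C := by
  have hdigit (i : ℕ) :
      hasDigit (C.foldr (fun e s => Nat.lor (Nat.pow 2 e.1) (Nat.lor (Nat.pow 2 e.2) s)) 0) i =
        C.any fun e => e.1 = i ∨ e.2 = i := by
    clear h
    induction C with
    | nil => exact hasDigit_zero i
    | cons e C ih =>
      rw [List.foldr_cons, hasDigit_lor, hasDigit_lor, ih, hasDigit_two_pow, hasDigit_two_pow,
        List.any_cons, ← Bool.or_assoc, Bool.decide_or]
  rw [covers, Nat.beq_eq]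
  refine eq_of_hasDigit_eq fun i => ?_
  rw [hasDigit_pred_two_pow, hdigit, Bool.eq_iff_iff, decide_eq_true_iff, List.any_eq_true, h]
  simp only [decide_eq_true_iff]

theorem beq_eq_decide (a b : ℕ) : Nat.beq a b = decide (a = b) := by
  rw [Bool.eq_iff_iff, Nat.beq_eq, decide_eq_true_iff]

theorem mem_pairs {N s : ℕ} {e : ℕ × ℕ} :
    e ∈ pairs N s ↔
      (e.1 < N ∧ e.2 < N) ∧ (e.1 + s ≤ e.2 ∧ e.2 + s ≤ e.1 + N) ∧ e ≠ (0, s) := by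
  simp [pairs, Prod.ext_iff, beq_eq_decide, Nat.ble_eq, and_assoc, imp_iff_not_or]

theorem nodup_pairs (N s : ℕ) : (pairs N s).Nodup :=
  (List.Nodup.product List.nodup_range List.nodup_range).filter _

theorem cons_mem_diagrams {N s : ℕ} {C : List (ℕ × ℕ)} (hs : 0 < s) (hsN : s < N)
    (hC : C.Sublist (pairs N s)) (hcovers : covers N ((0, s) :: C)) :
    (0, s) :: C ∈ diagrams (C.length + 1) N := by
  refine List.mem_flatMap.2 ⟨s, List.mem_range.2 hsN, ?_⟩
  rw [beq_eq_decide, decide_eq_false hs.ne', cond_false]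
  exact List.mem_filter.2
    ⟨List.mem_map_of_mem (List.mem_sublistsLen.2 ⟨hC, rfl⟩), hcovers⟩

/-! ### Chords of a Hamiltonian cycle -/

section Cycle

variable {V : Type*} {G : SimpleGraph V} {v : V} {w : G.Walk v v}

theorem mem_neighborSet_toSubgraph {a b : V} :
    b ∈ w.toSubgraph.neighborSet a ↔ s(a, b) ∈ w.edges := by
  rw [SimpleGraph.Subgraph.mem_neighborSet, ← SimpleGraph.Subgraph.mem_edgeSet,
    w.mem_edges_toSubgraph]

theorem eq_or_eq_of_mem_edges (hw : w.IsCycle) {a x y z : V} (hx : s(a, x) ∈ w.edges)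
    (hy : s(a, y) ∈ w.edges) (hxy : x ≠ y) (hz : s(a, z) ∈ w.edges) : z = x ∨ z = y := by
  have hncard := hw.ncard_neighborSet_toSubgraph_eq_two (w.fst_mem_support_of_mem_edges hx)
  have hpair : {x, y} = w.toSubgraph.neighborSet a := by
    refine Set.eq_of_subset_of_ncard_le ?_ (by rw [hncard, Set.ncard_pair hxy])
      (Set.finite_of_ncard_ne_zero (by omega))
    rintro b (rfl | rfl)
    exacts [mem_neighborSet_toSubgraph.2 hx, mem_neighborSet_toSubgraph.2 hy]
  exact (hpair ▸ mem_neighborSet_toSubgraph.2 hz : z ∈ ({x, y} : Set V))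

theorem mem_of_mem_support {S : Set V} {a b : V} (ha : a ∈ S) (haw : a ∈ w.support)
    (hS : ∀ x ∈ S, ∀ y, s(x, y) ∈ w.edges → y ∈ S) (hb : b ∈ w.support) : b ∈ S := by
  classical
  by_contra hbS
  have hb' : b ∈ (w.rotate a haw).support := (SimpleGraph.Walk.mem_support_rotate_iff ..).2 hb
  obtain ⟨d, hd, hfst, hsnd⟩ :=
    ((w.rotate a haw).takeUntil b hb').exists_boundary_dart S ha hbS
  have hd' : d.edge ∈ (w.rotate a haw).edges :=
    (w.rotate a haw).edges_takeUntil_subset_edges hb' (List.mem_map_of_mem hd)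
  exact hsnd (hS _ hfst _ ((w.rotate_edges a haw).mem_iff.1 hd'))

end Cycle

section Ring

variable {n : ℕ}

theorem natCast_ne_of_lt {a b : ℕ} (hab : a < b) (hb : b < a + n) : (a : ZMod n) ≠ b := by
  intro h
  have := Nat.le_of_dvd (by omega)
    ((Nat.modEq_iff_dvd' hab.le).1 ((ZMod.natCast_eq_natCast_iff a b n).1 h))
  omega

/-- The edge from `x` to its successor on the ring of all the numbers modulo `n`. -/
def ringEdge (x : ZMod n) : Sym2 (ZMod n) := s(x, x + 1)

theorem mem_ringEdge {x y : ZMod n} : y ∈ ringEdge x ↔ x = y ∨ x = y - 1 := by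
  rw [ringEdge, Sym2.mem_iff, eq_sub_iff_add_eq, eq_comm, eq_comm (a := y)]

theorem ringEdge_injective (hn : 3 ≤ n) : Function.Injective (ringEdge (n := n)) := by
  intro x y h
  obtain ⟨h, -⟩ | ⟨h, h'⟩ := Sym2.eq_iff.1 h
  · exact h
  · refine absurd ?_ (natCast_ne_of_lt (n := n) zero_lt_two (by omega))
    rw [h] at h'
    push_cast
    linear_combination -h'

variable {G : SimpleGraph (ZMod n)}

/-- The vertices `x` and `y` are joined by an edge that does not belong to the ring. -/
def IsChord (G : SimpleGraph (ZMod n)) (x y : ZMod n) : Prop :=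
  G.Adj x y ∧ y ≠ x + 1 ∧ x ≠ y + 1

theorem IsChord.symm {x y : ZMod n} (h : IsChord G x y) : IsChord G y x :=
  ⟨h.1.symm, h.2.2, h.2.1⟩

theorem IsChord.ne {x y : ZMod n} (h : IsChord G x y) : x ≠ y := h.1.ne

theorem IsChord.ringEdge_ne {x y : ZMod n} (h : IsChord G x y) (z : ZMod n) :
    ringEdge z ≠ s(x, y) := by
  intro he
  obtain ⟨rfl, h'⟩ | ⟨rfl, h'⟩ := Sym2.eq_iff.1 he
  exacts [h.2.1 h'.symm, h.2.2 h'.symm]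

theorem isChord_or_exists_ringEdge_eq {x y : ZMod n} (h : G.Adj x y) :
    IsChord G x y ∨ ∃ z, ringEdge z = s(x, y) := by
  by_cases hy : y = x + 1
  · exact .inr ⟨x, hy ▸ rfl⟩
  by_cases hx : x = y + 1
  · exact .inr ⟨y, hx ▸ Sym2.eq_swap⟩
  · exact .inl ⟨h, hy, hx⟩

/-- The ends of the chords of `G`, in their order around the ring, are the classes modulo `n` of
`p 0, …, p (N - 1)`; the sequence `p` continues periodically, so that it can be started at any
end. -/
structure IsDrawing (G : SimpleGraph (ZMod n)) (N : ℕ) (p : ℕ → ℕ) : Prop where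
  adj_add_one : ∀ x, G.Adj x (x + 1)
  strictMono : StrictMono p
  apply_add : ∀ i, p (i + N) = p i + n
  exists_isChord_iff : ∀ x : ZMod n, (∃ y, IsChord G x y) ↔ ∃ i, (p i : ZMod n) = x

namespace IsDrawing

variable {N : ℕ} {p : ℕ → ℕ} (h : IsDrawing G N p)
include h

theorem apply_add_mul (i m : ℕ) : p (i + N * m) = p i + n * m := by
  induction m with
  | zero => rfl
  | succ m ih => rw [Nat.mul_succ, ← add_assoc, h.apply_add, ih, Nat.mul_succ, add_assoc]

theorem natCast_apply_add (i : ℕ) : (p (i + N) : ZMod n) = p i := by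
  simp [h.apply_add]

theorem natCast_apply_mod (i : ℕ) : (p (i % N) : ZMod n) = p i := by
  conv_rhs => rw [← Nat.mod_add_div i N, h.apply_add_mul]
  simp

theorem natCast_apply_ne {i j : ℕ} (hij : i < j) (hj : j < i + N) :
    (p i : ZMod n) ≠ p j :=
  natCast_ne_of_lt (h.strictMono hij) (h.apply_add i ▸ h.strictMono hj)

theorem natCast_apply_injOn : Set.InjOn (fun i => (p i : ZMod n)) (Set.Iio N) := by
  intro i hi j hj hij
  rw [Set.mem_Iio] at hi hj
  obtain hlt | rfl | hlt := lt_trichotomy i j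
  · exact absurd hij (h.natCast_apply_ne hlt (by omega))
  · rfl
  · exact absurd hij.symm (h.natCast_apply_ne hlt (by omega))

theorem not_isChord {r x : ℕ} (hrx : p r < x) (hx : x < p (r + 1)) (y : ZMod n) :
    ¬ IsChord G x y := by
  intro hxy
  obtain ⟨i, hi⟩ := (h.exists_isChord_iff x).1 ⟨y, hxy⟩
  rw [ZMod.natCast_eq_natCast_iff] at hi
  have hgap {s j m : ℕ} (hs : p s + n * m < p j) (hs' : p j < p (s + 1) + n * m) : False := by
    rw [← h.apply_add_mul, h.strictMono.lt_iff_lt] at hs hs'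
    omega
  obtain hle | hle := le_total (p i) x
  · obtain ⟨m, hm⟩ := (Nat.modEq_iff_dvd' hle).1 hi
    refine hgap (s := r) (j := i + N * m) (m := 0) ?_ ?_ <;> rw [h.apply_add_mul] <;> omega
  · obtain ⟨m, hm⟩ := (Nat.modEq_iff_dvd' hle).1 hi.symm
    exact hgap (s := r) (j := i) (m := m) (by omega) (by omega)

theorem pos [NeZero n] : 0 < N := by
  rw [pos_iff_ne_zero]
  rintro rfl
  have := h.apply_add 0
  have := NeZero.ne n
  simp_all

theorem shift [NeZero n] (i : ℕ) : IsDrawing G N fun j => p (i + j) where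
  adj_add_one := h.adj_add_one
  strictMono := h.strictMono.comp (strictMono_id.const_add i)
  apply_add j := by rw [← add_assoc, h.apply_add]
  exists_isChord_iff x := by
    rw [h.exists_isChord_iff]
    constructor
    · rintro ⟨j, rfl⟩
      have hle : i ≤ N * i := Nat.le_mul_of_pos_left i h.pos
      refine ⟨j + N * i - i, ?_⟩
      rw [Nat.add_sub_cancel' (by omega), h.apply_add_mul]
      simp
    · exact fun ⟨j, hj⟩ => ⟨i + j, hj⟩

end IsDrawing

theorem exists_isDrawing [NeZero n] (hring : ∀ x, G.Adj x (x + 1)) (hchord : ∃ x y, IsChord G x y) :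
    ∃ N p, IsDrawing G N p := by
  classical
  let IsEnd (a : ℕ) : Prop := ∃ y, IsChord G a y
  have hperiodic (a : ℕ) : IsEnd (n + a) ↔ IsEnd a := by simp [IsEnd]
  have hinf : ({a | IsEnd a}).Infinite := by
    obtain ⟨x, y, hxy⟩ := hchord
    refine Set.infinite_of_forall_exists_gt fun a => ⟨x.val + n * (a + 1), ?_, ?_⟩
    · exact ⟨y, by simpa using hxy⟩
    · have := Nat.le_mul_of_pos_left (a + 1) (NeZero.pos n)
      omega
  refine ⟨Nat.count IsEnd n, Nat.nth IsEnd, hring, Nat.nth_strictMono hinf, fun i => ?_,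
    fun x => ?_⟩
  · have hcount : Nat.count IsEnd (n + Nat.nth IsEnd i) = i + Nat.count IsEnd n := by
      rw [Nat.count_add]
      simp only [hperiodic]
      rw [Nat.count_nth_of_infinite hinf, add_comm]
    rw [← hcount, Nat.nth_count ((hperiodic _).2 (Nat.nth_mem_of_infinite hinf i)), add_comm]
  · constructor
    · rintro ⟨y, hxy⟩
      have hx : IsEnd x.val := ⟨y, by simpa using hxy⟩
      exact ⟨Nat.count IsEnd x.val, by simp [Nat.nth_count hx]⟩
    · rintro ⟨i, rfl⟩
      exact Nat.nth_mem_of_infinite hinf i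

/-- The edge that a pair of ends of chords stands for. -/
def chordEdge (n : ℕ) (p : ℕ → ℕ) (e : ℕ × ℕ) : Sym2 (ZMod n) :=
  s((p e.1 : ZMod n), (p e.2 : ZMod n))

/-- The list `C` has each chord of `G` once, as the pair of the numbers of its ends. -/
structure IsChordList (G : SimpleGraph (ZMod n)) (N : ℕ) (p : ℕ → ℕ) (C : List (ℕ × ℕ)) :
    Prop where
  nodup : C.Nodup
  mem_iff : ∀ e, e ∈ C ↔ e.1 < e.2 ∧ e.2 < N ∧ IsChord G (p e.1) (p e.2)

namespace IsDrawing

variable {N : ℕ} {p : ℕ → ℕ} (h : IsDrawing G N p) {C : List (ℕ × ℕ)} (hC : IsChordList G N p C)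
include h

theorem exists_lt_of_isChord [NeZero n] {x y : ZMod n} (hxy : IsChord G x y) :
    ∃ i < N, (p i : ZMod n) = x := by
  obtain ⟨i, hi⟩ := (h.exists_isChord_iff x).1 ⟨y, hxy⟩
  exact ⟨i % N, Nat.mod_lt i h.pos, (h.natCast_apply_mod i).trans hi⟩

include hC

theorem exists_chordEdge_eq [NeZero n] {x y : ZMod n} (hxy : IsChord G x y) :
    ∃ e ∈ C, chordEdge n p e = s(x, y) := by
  obtain ⟨i, hi, rfl⟩ := h.exists_lt_of_isChord hxy
  obtain ⟨j, hj, rfl⟩ := h.exists_lt_of_isChord hxy.symm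
  obtain hlt | rfl | hlt := lt_trichotomy i j
  · exact ⟨(i, j), (hC.mem_iff _).2 ⟨hlt, hj, hxy⟩, rfl⟩
  · exact absurd rfl hxy.ne
  · exact ⟨(j, i), (hC.mem_iff _).2 ⟨hlt, hi, hxy.symm⟩, Sym2.eq_swap⟩

theorem mem_chordEdge_iff {i : ℕ} (hi : i < N) {e : ℕ × ℕ} (he : e ∈ C) :
    (p i : ZMod n) ∈ chordEdge n p e ↔ e.1 = i ∨ e.2 = i := by
  obtain ⟨hlt, hN, -⟩ := (hC.mem_iff e).1 he
  rw [chordEdge, Sym2.mem_iff, eq_comm, eq_comm (b := (p e.2 : ZMod n))]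
  exact or_congr (h.natCast_apply_injOn.eq_iff (hlt.trans hN) hi)
    (h.natCast_apply_injOn.eq_iff hN hi)

theorem chordEdge_injOn : Set.InjOn (chordEdge n p) {e | e ∈ C} := by
  intro e he f hf hef
  obtain ⟨hlt, hN, -⟩ := (hC.mem_iff e).1 he
  obtain ⟨hlt', -, -⟩ := (hC.mem_iff f).1 hf
  have hfst := (h.mem_chordEdge_iff hC (hlt.trans hN) hf).1 (hef ▸ Sym2.mem_mk_left _ _)
  have hsnd := (h.mem_chordEdge_iff hC hN hf).1 (hef ▸ Sym2.mem_mk_right _ _)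
  ext <;> omega

theorem coe_eq_map_add_map [NeZero n] (hn : 3 ≤ n) {E : List (Sym2 (ZMod n))} (hE : E.Nodup)
    (hEG : ∀ e ∈ E, e ∈ G.edgeSet) :
    (E : Multiset (Sym2 (ZMod n))) =
      ((C.filter (chordEdge n p · ∈ E) : List (ℕ × ℕ)) : Multiset (ℕ × ℕ)).map (chordEdge n p) +
        ({x | ringEdge x ∈ E} : Finset (ZMod n)).val.map ringEdge := by
  refine (Multiset.Nodup.ext (Multiset.coe_nodup.2 hE) ?_).2 fun e => ?_
  · refine Multiset.nodup_add.2 ⟨?_, (Finset.nodup _).map (ringEdge_injective hn), ?_⟩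
    · refine Multiset.Nodup.map_on (fun e he f hf => ?_) (hC.nodup.filter _)
      exact h.chordEdge_injOn hC (List.mem_of_mem_filter he) (List.mem_of_mem_filter hf)
    · refine Multiset.disjoint_left.2 fun he he' => ?_
      obtain ⟨c, hc, rfl⟩ := Multiset.mem_map.1 he
      obtain ⟨x, -, hx⟩ := Multiset.mem_map.1 he'
      exact ((hC.mem_iff c).1 (List.mem_of_mem_filter hc)).2.2.ringEdge_ne x hx
  · rw [Multiset.mem_add, Multiset.mem_map, Multiset.mem_map, Multiset.mem_coe]
    constructor
    · intro he
      induction e with | _ x y =>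
      obtain hxy | ⟨z, hz⟩ := isChord_or_exists_ringEdge_eq (hEG _ he)
      · obtain ⟨c, hc, hcxy⟩ := h.exists_chordEdge_eq hC hxy
        exact .inl ⟨c, List.mem_filter.2 ⟨hc, by simpa [hcxy]⟩, hcxy⟩
      · exact .inr ⟨z, by simpa [hz], hz⟩
    · rintro (⟨c, hc, rfl⟩ | ⟨x, hx, rfl⟩)
      · simpa using (List.mem_filter.1 hc).2
      · simpa using hx

theorem ncard_edgeSet [NeZero n] (hn : 3 ≤ n) : G.edgeSet.ncard = n + C.length := by
  classical
  have hmem (e : Sym2 (ZMod n)) : e ∈ G.edgeFinset.toList ↔ e ∈ G.edgeSet :=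
    mem_toList.trans SimpleGraph.mem_edgeFinset
  have hcard := congrArg Multiset.card (h.coe_eq_map_add_map hC hn G.edgeFinset.nodup_toList
    fun e he => (hmem e).1 he)
  have hchords : C.filter (chordEdge n p · ∈ G.edgeFinset.toList) = C :=
    List.filter_eq_self.2 fun e he => decide_eq_true ((hmem _).2 ((hC.mem_iff e).1 he).2.2.1)
  have hring : ({x | ringEdge x ∈ G.edgeFinset.toList} : Finset (ZMod n)) = univ :=
    filter_true_of_mem fun x _ => (hmem _).2 (h.adj_add_one x)
  rw [hchords, hring, Multiset.card_add, Multiset.card_map, Multiset.card_map, card_val,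
    Multiset.coe_card, Multiset.coe_card, length_toList, card_univ, ZMod.card] at hcard
  rw [← SimpleGraph.coe_edgeFinset, Set.ncard_coe_finset, hcard, add_comm]

end IsDrawing

end Ring

section CyclesOnRing

variable {n : ℕ} {G : SimpleGraph (ZMod n)} {v : ZMod n} {w : G.Walk v v}

theorem add_one_mem_support (hw : w.IsCycle)
    (hchord : ∀ x y, s(x, y) ∈ w.edges → ¬ IsChord G x y) {x : ZMod n} (hx : x ∈ w.support) :
    x + 1 ∈ w.support := by
  have hsub : w.toSubgraph.neighborSet x ⊆ {x + 1, x - 1} := by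
    intro y hy
    have hedge := mem_neighborSet_toSubgraph.1 hy
    have hnot := hchord x y hedge
    have hadj := w.adj_of_mem_edges hedge
    rw [Set.mem_insert_iff, Set.mem_singleton_iff, eq_sub_iff_add_eq, eq_comm (b := x)]
    unfold IsChord at hnot
    tauto
  have heq := Set.eq_of_subset_of_ncard_le hsub (by
    rw [hw.ncard_neighborSet_toSubgraph_eq_two hx]
    exact (Set.ncard_insert_le ..).trans_eq (by rw [Set.ncard_singleton]))
  exact w.snd_mem_support_of_mem_edges
    (mem_neighborSet_toSubgraph.1 (heq ▸ Set.mem_insert _ _))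

theorem length_eq_of_forall_not_isChord [NeZero n] (hw : w.IsCycle)
    (hchord : ∀ x y, s(x, y) ∈ w.edges → ¬ IsChord G x y) : w.length = n := by
  have hsupport (k : ℕ) : v + k ∈ w.support := by
    induction k with
    | zero => simp
    | succ k ih => simpa [add_assoc] using add_one_mem_support hw hchord ih
  have hham : w.IsHamiltonianCycle := by
    refine SimpleGraph.Walk.isHamiltonianCycle_iff_isCycle_and_support_count_tail_eq_one.2
      ⟨hw, fun x => List.count_eq_one_of_mem hw.support_nodup ?_⟩
    have hx : x ∈ w.support := by simpa using hsupport (x - v).val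
    rw [w.mem_support_iff] at hx
    obtain rfl | hx := hx
    · exact w.end_mem_tail_support hw.not_nil
    · exact hx
  rw [hham.length_eq, ZMod.card]

theorem neighbor_cases (hn : 3 ≤ n) (hw : w.IsCycle) {a b : ℕ} (hab : a < b)
    (hedge : s((a : ZMod n), (b : ZMod n)) ∈ w.edges) (hchord : IsChord G a b)
    (hring : ∀ x ∈ Ico a b, ringEdge (x : ZMod n) ∈ w.edges) {z : ℕ} (hz : a ≤ z ∧ z ≤ b)
    {y : ZMod n} (hy : s((z : ZMod n), y) ∈ w.edges) :
    (a < z ∧ y = z - 1) ∨ (z < b ∧ y = z + 1) ∨ (z = a ∧ y = b) ∨ (z = b ∧ y = a) := by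
  have hnext (z : ℕ) (hz : a ≤ z ∧ z < b) : s((z : ZMod n), (z : ZMod n) + 1) ∈ w.edges :=
    hring z (mem_Ico.2 hz)
  have hprev (z : ℕ) (hz : a < z ∧ z ≤ b) : s((z : ZMod n), (z : ZMod n) - 1) ∈ w.edges := by
    have := hnext (z - 1) (by omega)
    rwa [Nat.cast_pred (by omega), sub_add_cancel, Sym2.eq_swap] at this
  obtain rfl | hza := eq_or_lt_of_le hz.1
  · have := eq_or_eq_of_mem_edges hw hedge (hnext a ⟨le_rfl, hab⟩) hchord.2.1 hy
    tauto
  obtain rfl | hzb := eq_or_lt_of_le hz.2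
  · have := eq_or_eq_of_mem_edges hw (Sym2.eq_swap ▸ hedge) (hprev z ⟨hab, le_rfl⟩)
      (fun h => hchord.2.1 (eq_sub_iff_add_eq.1 h).symm) hy
    tauto
  · have hne : (z : ZMod n) - 1 ≠ z + 1 := fun h =>
      natCast_ne_of_lt (n := n) (a := 0) zero_lt_two (by omega)
        (by push_cast; linear_combination h)
    have := eq_or_eq_of_mem_edges hw (hprev z ⟨hza, hz.2⟩) (hnext z ⟨hz.1, hzb⟩) hne hy
    tauto

theorem eq_of_isChord_of_mem_edges (hn : 3 ≤ n) (hw : w.IsCycle) {a b : ℕ} (hab : a < b)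
    (hedge : s((a : ZMod n), (b : ZMod n)) ∈ w.edges) (hchord : IsChord G a b)
    (hring : ∀ x ∈ Ico a b, ringEdge (x : ZMod n) ∈ w.edges) {x y : ZMod n}
    (hxy : IsChord G x y) (hmem : s(x, y) ∈ w.edges) : s(x, y) = s((a : ZMod n), (b : ZMod n)) := by
  -- The cycle cannot leave the set of the vertices from `a` to `b`.
  have hx : x ∈ Nat.cast '' Set.Icc a b := by
    refine mem_of_mem_support (a := (a : ZMod n)) ⟨a, ⟨le_rfl, hab.le⟩, rfl⟩
      (w.fst_mem_support_of_mem_edges hedge) ?_ (w.fst_mem_support_of_mem_edges hmem)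
    rintro _ ⟨z, hz, rfl⟩ y hy
    obtain ⟨hlt, rfl⟩ | ⟨hlt, rfl⟩ | ⟨-, rfl⟩ | ⟨-, rfl⟩ :=
      neighbor_cases hn hw hab hedge hchord hring hz hy
    · exact ⟨z - 1, ⟨by omega, by have := hz.2; omega⟩, Nat.cast_pred (by omega)⟩
    · exact ⟨z + 1, ⟨by have := hz.1; omega, hlt⟩, Nat.cast_succ z⟩
    · exact ⟨b, ⟨hab.le, le_rfl⟩, rfl⟩
    · exact ⟨a, ⟨le_rfl, hab.le⟩, rfl⟩
  obtain ⟨z, hz, rfl⟩ := hx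
  obtain ⟨-, rfl⟩ | ⟨-, rfl⟩ | ⟨rfl, rfl⟩ | ⟨rfl, rfl⟩ :=
    neighbor_cases hn hw hab hedge hchord hring hz hmem
  · exact absurd (sub_add_cancel _ _).symm hxy.2.2
  · exact absurd rfl hxy.2.1
  · rfl
  · exact Sym2.eq_swap

end CyclesOnRing

section Diagram

variable {n : ℕ} [NeZero n] {G : SimpleGraph (ZMod n)} {N : ℕ} {p : ℕ → ℕ}

theorem exists_isDrawing_of_shortest (hring : ∀ x, G.Adj x (x + 1))
    (hchord : ∃ x y, IsChord G x y) :
    ∃ N p s, IsDrawing G N p ∧ 0 < s ∧ IsChord G (p 0) (p s) ∧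
      ∀ i j, i < j → IsChord G (p i) (p j) → i + s ≤ j := by
  classical
  obtain ⟨N, q, hq⟩ := exists_isDrawing hring hchord
  have hspan : ∃ s, 0 < s ∧ ∃ i, IsChord G (q i) (q (i + s)) := by
    obtain ⟨x, y, hxy⟩ := hchord
    obtain ⟨i, rfl⟩ := (hq.exists_isChord_iff x).1 ⟨y, hxy⟩
    obtain ⟨j, rfl⟩ := (hq.exists_isChord_iff y).1 ⟨_, hxy.symm⟩
    obtain hlt | rfl | hlt := lt_trichotomy i j
    · exact ⟨j - i, by omega, i, by rwa [Nat.add_sub_cancel' hlt.le]⟩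
    · exact absurd rfl hxy.ne
    · exact ⟨i - j, by omega, j, by simpa [Nat.add_sub_cancel' hlt.le] using hxy.symm⟩
  obtain ⟨hpos, i, hi⟩ := Nat.find_spec hspan
  refine ⟨N, _, Nat.find hspan, hq.shift i, hpos, hi, fun a b hab h => ?_⟩
  have := Nat.find_min' hspan ⟨Nat.sub_pos_of_lt hab, i + a,
    by rwa [add_assoc, Nat.add_sub_cancel' hab.le]⟩
  omega

theorem IsDrawing.lt_of_shortest (h : IsDrawing G N p) {s : ℕ} (hs : IsChord G (p 0) (p s))
    (hmin : ∀ i j, i < j → IsChord G (p i) (p j) → i + s ≤ j) : s < N := by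
  by_contra! hN
  have hs' : IsChord G (p 0) (p (s - N)) := by
    rwa [← h.natCast_apply_add (s - N), Nat.sub_add_cancel hN]
  obtain hzero | hpos := Nat.eq_zero_or_pos (s - N)
  · exact hs'.ne (by rw [hzero])
  · have := hmin _ _ hpos hs'
    have := h.pos
    omega

theorem IsDrawing.lt_iff_exists_mem (h : IsDrawing G N p) {C : List (ℕ × ℕ)}
    (hC : IsChordList G N p C) (i : ℕ) : i < N ↔ ∃ e ∈ C, e.1 = i ∨ e.2 = i := by
  constructor
  · intro hi
    obtain ⟨y, hy⟩ := (h.exists_isChord_iff (p i)).2 ⟨i, rfl⟩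
    obtain ⟨e, he, hey⟩ := h.exists_chordEdge_eq hC hy
    exact ⟨e, he, (h.mem_chordEdge_iff hC hi he).1 (hey ▸ Sym2.mem_mk_left _ _)⟩
  · rintro ⟨e, he, rfl | rfl⟩ <;> have := (hC.mem_iff e).1 he <;> omega

theorem IsDrawing.le_two_mul_length (h : IsDrawing G N p) {C : List (ℕ × ℕ)}
    (hC : IsChordList G N p C) : N ≤ 2 * C.length := by
  have hsub : range N ⊆ (C.flatMap fun e => [e.1, e.2]).toFinset := by
    intro i hi
    obtain ⟨e, he, hei⟩ := (h.lt_iff_exists_mem hC i).1 (mem_range.1 hi)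
    simp only [List.mem_toFinset, List.mem_flatMap, List.mem_cons, List.not_mem_nil, or_false]
    exact ⟨e, he, hei.imp Eq.symm Eq.symm⟩
  have hcard := (card_le_card hsub).trans (List.toFinset_card_le _)
  simpa [mul_comm] using hcard

theorem exists_isChordList (hring : ∀ x, G.Adj x (x + 1)) (hchord : ∃ x y, IsChord G x y) :
    ∃ N p C, IsDrawing G N p ∧ IsChordList G N p C ∧ C ∈ diagrams C.length N := by
  classical
  obtain ⟨N, p, s, h, hpos, hs, hmin⟩ := exists_isDrawing_of_shortest hring hchord
  have hsN := h.lt_of_shortest hs hmin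
  set C := (pairs N s).filter fun e => IsChord G (p e.1) (p e.2) with hCdef
  have hC : IsChordList G N p ((0, s) :: C) := by
    refine ⟨List.nodup_cons.2 ⟨?_, (nodup_pairs N s).filter _⟩, fun e => ?_⟩
    · exact fun hmem => (mem_pairs.1 (List.mem_of_mem_filter hmem)).2.2 rfl
    · rw [List.mem_cons, hCdef, List.mem_filter, mem_pairs, decide_eq_true_iff]
      constructor
      · rintro (rfl | ⟨⟨⟨-, hN⟩, ⟨hlt, -⟩, -⟩, he⟩)
        · exact ⟨hpos, hsN, hs⟩
        · exact ⟨by omega, hN, he⟩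
      · rintro ⟨hlt, hN, he⟩
        have hle := hmin _ _ hlt he
        have hle' := hmin e.2 (e.1 + N) (by omega) (by rw [h.natCast_apply_add]; exact he.symm)
        by_cases heq : e = (0, s)
        · exact .inl heq
        · exact .inr ⟨⟨⟨by omega, hN⟩, ⟨hle, hle'⟩, heq⟩, he⟩
  exact ⟨N, p, _, h, hC, cons_mem_diagrams hpos hsN List.filter_sublist
    (covers_of_forall (h.lt_iff_exists_mem hC))⟩

end Diagram

/-! ### Lengths of cycles as values of forms -/

theorem card_filter_natCast {n : ℕ} [NeZero n] (a : ℕ) (P : ZMod n → Prop) [DecidablePred P] :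
    #((Ico a (a + n)).filter fun x : ℕ => P x) = #{x | P x} := by
  refine card_nbij (fun x => (x : ZMod n)) (fun x hx => ?_) (fun x hx y hy hxy => ?_) fun y hy => ?_
  · simpa using (mem_filter.1 hx).2
  · simp only [coe_filter, Set.mem_ofPred_eq, mem_Ico] at hx hy
    obtain hlt | rfl | hlt := lt_trichotomy x y
    · exact absurd hxy (natCast_ne_of_lt hlt (by omega))
    · rfl
    · exact absurd hxy.symm (natCast_ne_of_lt hlt (by omega))
  · have hcast : ((a + (y - a).val : ℕ) : ZMod n) = y := by simp
    refine ⟨_, ?_, hcast⟩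
    have := (y - a).val_lt
    have hP : P y := by simpa using hy
    simp only [coe_filter, Set.mem_ofPred_eq, mem_Ico, hcast]
    exact ⟨by omega, hP⟩

section Form

variable {n : ℕ} {G : SimpleGraph (ZMod n)} {N : ℕ} {p : ℕ → ℕ} {C : List (ℕ × ℕ)}
  {v : ZMod n} {w : G.Walk v v}

/-- The chords of the list `C` that the walk `w` uses. -/
def usedChords (p : ℕ → ℕ) (C : List (ℕ × ℕ)) (w : G.Walk v v) : List (ℕ × ℕ) :=
  C.filter (chordEdge n p · ∈ w.edges)

theorem mem_usedChords {e : ℕ × ℕ} :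
    e ∈ usedChords p C w ↔ e ∈ C ∧ chordEdge n p e ∈ w.edges := by
  rw [usedChords, List.mem_filter, decide_eq_true_iff]

theorem lt_of_mem_usedChords (hC : IsChordList G N p C) {e : ℕ × ℕ} (he : e ∈ usedChords p C w) :
    e.1 < e.2 ∧ e.2 < N :=
  have hmem := (hC.mem_iff e).1 (mem_usedChords.1 he).1
  ⟨hmem.1, hmem.2.1⟩

namespace IsDrawing

variable [NeZero n] (h : IsDrawing G N p) (hC : IsChordList G N p C) (hn : 3 ≤ n)
include h hC hn

theorem coe_edges (hw : w.IsTrail) :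
    (w.edges : Multiset (Sym2 (ZMod n))) =
      (usedChords p C w : Multiset (ℕ × ℕ)).map (chordEdge n p) +
        ({x | ringEdge x ∈ w.edges} : Finset (ZMod n)).val.map ringEdge :=
  h.coe_eq_map_add_map hC hn hw.edges_nodup fun _ he => w.edges_subset_edgeSet he

theorem length_eq (hw : w.IsTrail) :
    w.length = (usedChords p C w).length + #{x : ZMod n | ringEdge x ∈ w.edges} := by
  have hcard := congrArg Multiset.card (h.coe_edges hC hn hw)
  rwa [Multiset.card_add, Multiset.card_map, Multiset.card_map, Multiset.coe_card,
    Multiset.coe_card, w.length_edges, card_val] at hcard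

theorem decide_ringEdge_mem (hw : w.IsTrail) (y : ZMod n) :
    decide (ringEdge y ∈ w.edges) = (decide (ringEdge (y - 1) ∈ w.edges) ^^
      decide (Odd ((usedChords p C w).countP (y ∈ chordEdge n p ·)))) := by
  have heven : Even (w.edges.countP (y ∈ ·)) := (hw.even_countP_edges_iff y).2 (absurd rfl)
  have hne : y ≠ y - 1 := by
    have : Fact (1 < n) := ⟨by omega⟩
    exact fun h => one_ne_zero (α := ZMod n) (by linear_combination h)
  have hring : #{x : ZMod n | ringEdge x ∈ w.edges ∧ y ∈ ringEdge x} =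
      (if ringEdge y ∈ w.edges then 1 else 0) + (if ringEdge (y - 1) ∈ w.edges then 1 else 0) := by
    have hpair : ({x | ringEdge x ∈ w.edges ∧ y ∈ ringEdge x} : Finset (ZMod n)) =
        {x ∈ ({y, y - 1} : Finset (ZMod n)) | ringEdge x ∈ w.edges} := by
      ext x
      simp [mem_ringEdge, and_comm]
    rw [hpair, card_filter, sum_pair hne]
  have hcount := congrArg (Multiset.countP (y ∈ ·)) (h.coe_edges hC hn hw)
  rw [Multiset.countP_add, Multiset.countP_map, Multiset.countP_map, ← filter_val, filter_filter,
    card_val, hring, ← Multiset.countP_eq_card_filter, Multiset.coe_countP,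
    Multiset.coe_countP] at hcount
  rw [hcount] at heven
  by_cases hy : ringEdge y ∈ w.edges <;> by_cases hy' : ringEdge (y - 1) ∈ w.edges <;>
    simp_all [Nat.even_add, parity_simps]

theorem decide_ringEdge_mem_apply (hw : w.IsTrail) {i : ℕ} (hi : i < N) :
    decide (ringEdge (p i : ZMod n) ∈ w.edges) =
      (decide (ringEdge ((p i : ZMod n) - 1) ∈ w.edges) ^^
        decide (Odd ((usedChords p C w).countP fun e => e.1 = i ∨ e.2 = i))) := by
  rw [h.decide_ringEdge_mem hC hn hw]
  congr 3
  refine List.countP_congr fun e he => ?_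
  simp only [decide_eq_true_iff]
  exact h.mem_chordEdge_iff hC hi (mem_usedChords.1 he).1

theorem ringEdge_mem_iff (hw : w.IsTrail) {r x : ℕ} (hrx : p r ≤ x) (hx : x < p (r + 1)) :
    ringEdge (x : ZMod n) ∈ w.edges ↔ ringEdge (p r : ZMod n) ∈ w.edges := by
  induction x, hrx using Nat.le_induction with
  | base => rfl
  | succ x hrx ih =>
    have hzero : (usedChords p C w).countP (((x + 1 : ℕ) : ZMod n) ∈ chordEdge n p ·) = 0 := by
      refine List.countP_eq_zero.2 fun e he hmem => ?_
      have he := ((hC.mem_iff e).1 (mem_usedChords.1 he).1).2.2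
      obtain hx' | hx' := Sym2.mem_iff.1 (of_decide_eq_true hmem)
      · exact h.not_isChord (Nat.lt_succ_of_le hrx) hx _ (hx' ▸ he)
      · exact h.not_isChord (Nat.lt_succ_of_le hrx) hx _ (hx' ▸ he.symm)
    have hdecide := h.decide_ringEdge_mem hC hn hw ((x + 1 : ℕ) : ZMod n)
    rw [hzero, Nat.cast_succ, add_sub_cancel_right] at hdecide
    rw [← ih (by omega), Nat.cast_succ]
    simpa using hdecide

theorem ringEdge_mem_of_forall (hw : w.IsTrail) {a b : ℕ} (hab : a ≤ b)
    (hgaps : ∀ r ∈ Ico a b, ringEdge (p r : ZMod n) ∈ w.edges) :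
    ∀ x ∈ Ico (p a) (p b), ringEdge (x : ZMod n) ∈ w.edges := by
  induction b, hab using Nat.le_induction with
  | base => simp
  | succ b hab ih =>
    intro x hx
    obtain hlt | hle := lt_or_ge x (p b)
    · refine ih (fun r hr => hgaps r ?_) x (mem_Ico.2 ⟨(mem_Ico.1 hx).1, hlt⟩)
      exact Ico_subset_Ico_right b.le_succ hr
    · exact (h.ringEdge_mem_iff hC hn hw hle (mem_Ico.1 hx).2).2
        (hgaps b (mem_Ico.2 ⟨hab, b.lt_succ_self⟩))

omit hC hn in
theorem card_filter_eq_sum (P : ZMod n → Prop) [DecidablePred P]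
    (hP : ∀ r x, p r ≤ x → x < p (r + 1) → (P x ↔ P (p r))) :
    #{x | P x} = ∑ r ∈ range N with P (p r), (p (r + 1) - p r) := by
  have hIco (m : ℕ) : #((Ico (p 0) (p m)).filter fun x : ℕ => P x) =
      ∑ r ∈ range m with P (p r), (p (r + 1) - p r) := by
    induction m with
    | zero => simp
    | succ m ih =>
      have hgap : #((Ico (p m) (p (m + 1))).filter fun x : ℕ => P x) =
          if P (p m) then p (m + 1) - p m else 0 := by
        rw [filter_congr fun x hx => hP m x (mem_Ico.1 hx).1 (mem_Ico.1 hx).2, filter_const]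
        split_ifs <;> simp
      rw [← Ico_union_Ico_eq_Ico (h.strictMono.monotone m.zero_le)
        (h.strictMono m.lt_succ_self).le, filter_union, card_union_of_disjoint
        (disjoint_filter_filter (Ico_disjoint_Ico_consecutive ..)), ih, hgap, sum_filter,
        sum_filter, sum_range_succ]
  have hN := h.apply_add 0
  rw [zero_add] at hN
  rw [← hIco, hN, card_filter_natCast]

theorem exists_hasDigit_usedGaps (hw : w.IsTrail) :
    ∃ b, ∀ r, hasDigit (usedGaps N b (usedChords p C w)) r =
      (decide (r < N) && decide (ringEdge (p r : ZMod n) ∈ w.edges)) := by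
  refine exists_hasDigit_usedGaps_eq (fun e he => lt_of_mem_usedChords hC he) h.pos fun r hr => ?_
  have hlt := h.strictMono r.lt_succ_self
  have hiff := h.ringEdge_mem_iff hC hn hw (Nat.le_sub_one_of_lt hlt) (Nat.sub_one_lt_of_lt hlt)
  rw [h.decide_ringEdge_mem_apply hC hn hw hr]
  rw [Nat.cast_pred (Nat.zero_lt_of_lt hlt)] at hiff
  rw [decide_eq_decide.2 hiff]

theorem not_passes (hw : w.IsCycle) {s : ℕ}
    (hs : ∀ r, hasDigit s r → ringEdge (p r : ZMod n) ∈ w.edges) {i : ℕ} {y : ZMod n}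
    (hy : IsChord G (p i) y) (hyw : s((p i : ZMod n), y) ∈ w.edges) : ¬ passes N s i := by
  intro hpass
  obtain ⟨hi, hprev⟩ := Bool.and_eq_true_iff.1 hpass
  have hN := h.pos
  have hlt : p (i + N - 1) < p (i + N) := h.strictMono (by omega)
  have hprev : ringEdge ((p i : ZMod n) - 1) ∈ w.edges := by
    have hmem : ringEdge (p (i + N - 1) : ZMod n) ∈ w.edges := by
      rw [← h.natCast_apply_mod]
      exact hs _ hprev
    rw [← h.natCast_apply_add, ← Nat.cast_pred (Nat.zero_lt_of_lt hlt)]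
    refine (h.ringEdge_mem_iff hC hn hw.isTrail (Nat.le_sub_one_of_lt hlt) ?_).2 hmem
    rw [Nat.sub_add_cancel (by omega)]
    exact Nat.sub_one_lt_of_lt hlt
  have hnext := hs i hi
  rw [ringEdge, sub_add_cancel, Sym2.eq_swap] at hprev
  rw [ringEdge] at hnext
  obtain heq | heq := eq_or_eq_of_mem_edges hw hyw hnext hy.2.1 hprev
  · exact hy.2.2 (eq_sub_iff_add_eq.1 heq.symm ▸ rfl)
  · refine natCast_ne_of_lt (n := n) (a := 0) zero_lt_two (by omega) ?_
    push_cast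
    linear_combination heq

theorem length_usedChords_eq_one (hw : w.IsCycle) {e : ℕ × ℕ} (he : e ∈ usedChords p C w)
    {a b : ℕ} (hab : a < b) (hchord : IsChord G (p a) (p b))
    (heq : chordEdge n p e = s((p a : ZMod n), (p b : ZMod n)))
    (hgaps : ∀ r ∈ Ico a b, ringEdge (p r : ZMod n) ∈ w.edges) :
    (usedChords p C w).length = 1 := by
  have hring := h.ringEdge_mem_of_forall hC hn hw.isTrail hab.le hgaps
  have hedge := (mem_usedChords.1 he).2
  rw [heq] at hedge
  have hall (f : ℕ × ℕ) (hf : f ∈ usedChords p C w) : f = e := by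
    obtain ⟨hfC, hfw⟩ := mem_usedChords.1 hf
    refine h.chordEdge_injOn hC hfC (mem_usedChords.1 he).1 (heq ▸ ?_)
    exact eq_of_isChord_of_mem_edges hn hw (h.strictMono hab) hedge hchord hring
      ((hC.mem_iff f).1 hfC).2.2 hfw
  have hnodup : (usedChords p C w).Nodup := hC.nodup.filter _
  rw [List.eq_replicate_of_mem hall, List.nodup_replicate] at hnodup
  exact hnodup.antisymm (List.length_pos_of_mem he)

theorem admissible_usedChords (hw : w.IsCycle) {s : ℕ}
    (hs : ∀ r, hasDigit s r = (decide (r < N) && decide (ringEdge (p r : ZMod n) ∈ w.edges))) :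
    admissible N (usedChords p C w) s := by
  have hring (r : ℕ) (hr : hasDigit s r) : ringEdge (p r : ZMod n) ∈ w.edges := by
    simp_all
  refine List.all_eq_true.2 fun e he => ?_
  obtain ⟨heC, hew⟩ := mem_usedChords.1 he
  obtain ⟨hlt, hN, hchord⟩ := (hC.mem_iff e).1 heC
  have hfst := h.not_passes hC hn hw hring hchord hew
  have hsnd := h.not_passes hC hn hw hring hchord.symm (Sym2.eq_swap ▸ hew)
  have harc (hinc : includes s (arc e)) : (usedChords p C w).length = 1 := by
    refine h.length_usedChords_eq_one hC hn hw he hlt hchord rfl fun r hr => hring r ?_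
    have := mem_Ico.1 hr
    refine includes_iff.1 hinc r ?_
    rw [hasDigit_arc, decide_eq_false (by omega), decide_eq_true this.2]
    rfl
  have hcompl (hinc : includes s (Nat.xor (Nat.pred (Nat.pow 2 N)) (arc e))) :
      (usedChords p C w).length = 1 := by
    have hcast := h.natCast_apply_add e.1
    refine h.length_usedChords_eq_one hC hn hw he (a := e.2) (b := e.1 + N) (by omega)
      (hcast ▸ hchord.symm) (hcast ▸ Sym2.eq_swap) fun r hr => ?_
    have := mem_Ico.1 hr
    rw [← h.natCast_apply_mod]
    refine hring _ (includes_iff.1 hinc _ ?_)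
    rw [hasDigit_xor, hasDigit_pred_two_pow, hasDigit_arc, decide_eq_true (Nat.mod_lt r h.pos)]
    obtain hlt' | hle := lt_or_ge r N
    · rw [Nat.mod_eq_of_lt hlt', decide_eq_false (by omega), decide_eq_false (by omega)]
      rfl
    · rw [Nat.mod_eq_sub_mod hle, Nat.mod_eq_of_lt (by omega), decide_eq_true (by omega),
        decide_eq_true (by omega)]
      rfl
  rw [Bool.and_eq_true_iff, Bool.and_eq_true_iff, Bool.or_eq_true, Bool.and_eq_true_iff]
  simp only [Bool.not_eq_true', ← Bool.not_eq_true, Nat.beq_eq]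
  tauto

theorem exists_mem_forms_eval_eq (hw : w.IsCycle) (hlength : w.length ≠ n) :
    ∃ f ∈ forms N C, eval (fun r => p (r + 1) - p r) f = w.length := by
  obtain ⟨b, hb⟩ := h.exists_hasDigit_usedGaps hC hn hw.isTrail
  have hne : usedChords p C w ≠ [] := by
    contrapose! hlength
    refine length_eq_of_forall_not_isChord hw fun x y hxy hchord => ?_
    obtain ⟨e, he, heq⟩ := h.exists_chordEdge_eq hC hchord
    exact List.not_mem_nil (hlength ▸ mem_usedChords.2 ⟨he, heq ▸ hxy⟩)
  refine ⟨((usedChords p C w).length, usedGaps N b (usedChords p C w)),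
    mem_forms List.filter_sublist hne (h.admissible_usedChords hC hn hw hb), ?_⟩
  have hgaps : gaps (usedGaps N b (usedChords p C w)) =
      {r ∈ range N | ringEdge (p r : ZMod n) ∈ w.edges} := by
    ext r
    simp [mem_gaps, hb]
  rw [eval, hgaps, h.length_eq hC hn hw.isTrail, h.card_filter_eq_sum _ fun r x hrx hx =>
    h.ringEdge_mem_iff hC hn hw.isTrail hrx hx]

end IsDrawing

end Form

/-! ### The lower bound -/

/-- Whether the search shows that a graph on `n` vertices with `n + k` edges cannot be pancyclic
if `n ≥ n₀`. -/
def excludes (k n₀ : ℕ) : Bool :=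
  (List.range (2 * k + 1)).all fun N => (diagrams k N).all fun C => refuted N n₀ (forms N C)

theorem isPancyclic_of_iso {V W : Type*} [Fintype V] [Fintype W] {G : SimpleGraph V}
    {H : SimpleGraph W} (e : G ≃g H) (hG : IsPancyclic G) : IsPancyclic H := by
  intro ℓ hℓ hcard
  obtain ⟨v, w, hw, hlength⟩ := hG ℓ hℓ (hcard.trans_eq (Fintype.card_congr e.toEquiv).symm)
  exact ⟨_, w.map e.toHom, hw.map e.injective, by rwa [SimpleGraph.Walk.length_map]⟩

theorem exists_iso_forall_adj_add_one {V : Type*} [Fintype V] {G : SimpleGraph V}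
    (hV : 3 ≤ Fintype.card V) (hG : IsPancyclic G) :
    ∃ H : SimpleGraph (ZMod (Fintype.card V)), Nonempty (G ≃g H) ∧ ∀ x, H.Adj x (x + 1) := by
  classical
  set n := Fintype.card V
  have : NeZero n := ⟨by omega⟩
  obtain ⟨v, w, hw, hlength⟩ := hG n hV le_rfl
  have hinj : Function.Injective fun x : ZMod n => w.getVert x.val := by
    intro x y hxy
    have hx := x.val_lt
    have hy := y.val_lt
    exact ZMod.val_injective n (hw.getVert_injOn' (by grind) (by grind) hxy)
  have hbij := (Fintype.bijective_iff_injective_and_card _).2 ⟨hinj, ZMod.card n⟩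
  let e := Equiv.ofBijective _ hbij
  refine ⟨G.comap e, ⟨(SimpleGraph.Iso.comap e G).symm⟩, fun x => ?_⟩
  have hx := x.val_lt
  have hval : (x + 1).val = (x.val + 1) % n := by
    rw [← ZMod.val_natCast, Nat.cast_succ, ZMod.natCast_rightInverse x]
  have hadj := w.adj_getVert_succ (i := x.val) (by omega)
  change G.Adj (w.getVert x.val) (w.getVert (x + 1).val)
  rw [hval]
  obtain hlt | heq := Nat.lt_or_eq_of_le (Nat.succ_le_of_lt hx)
  · rwa [Nat.mod_eq_of_lt hlt]
  · have hend : w.getVert (x.val + 1) = v := w.getVert_of_length_le (hlength.trans heq.symm).le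
    rw [hend] at hadj
    rwa [← Nat.succ_eq_add_one, heq, Nat.mod_self, w.getVert_zero]

theorem IsDrawing.lt_of_excludes {n n₀ : ℕ} [NeZero n] {G : SimpleGraph (ZMod n)}
    {N : ℕ} {p : ℕ → ℕ} {C : List (ℕ × ℕ)} (h : IsDrawing G N p) (hC : IsChordList G N p C)
    (hCN : C ∈ diagrams C.length N) (hn : 3 ≤ n) (hG : IsPancyclic G)
    (hexcl : excludes C.length n₀) : n < n₀ := by
  have hN : N ∈ List.range (2 * C.length + 1) :=
    List.mem_range.2 (Nat.lt_succ_of_le (h.le_two_mul_length hC))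
  have hrefuted := List.all_eq_true.1 (List.all_eq_true.1 hexcl N hN) C hCN
  refine lt_of_refuted hrefuted (g := fun r => p (r + 1) - p r)
    (fun r => Nat.sub_pos_of_lt (h.strictMono r.lt_succ_self)) ?_ fun ℓ hℓ => ?_
  · rw [sum_range_tsub h.strictMono.monotone, ← zero_add N, h.apply_add, Nat.add_sub_cancel_left]
  · obtain ⟨hℓ, hlt⟩ := mem_Ico.1 hℓ
    obtain ⟨v, w, hw, rfl⟩ := hG ℓ hℓ (hlt.le.trans_eq (ZMod.card n).symm)
    exact h.exists_mem_forms_eval_eq hC hn hw hlt.ne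

theorem exists_isChord {n : ℕ} [NeZero n] {G : SimpleGraph (ZMod n)} (hn : 3 < n)
    (hG : IsPancyclic G) : ∃ x y, IsChord G x y := by
  obtain ⟨v, w, hw, hlength⟩ := hG 3 le_rfl (by rw [ZMod.card]; exact hn.le)
  by_contra! hchord
  have := length_eq_of_forall_not_isChord hw fun x y _ => hchord x y
  omega

theorem ncard_edgeSet_ne_of_excludes {V : Type*} [Fintype V] {G : SimpleGraph V} {k n₀ : ℕ}
    (hV : 3 < Fintype.card V) (hG : IsPancyclic G) (hexcl : excludes k n₀)
    (hn₀ : n₀ ≤ Fintype.card V) : G.edgeSet.ncard ≠ Fintype.card V + k := by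
  obtain ⟨H, ⟨e⟩, hring⟩ := exists_iso_forall_adj_add_one hV.le hG
  have : NeZero (Fintype.card V) := ⟨by omega⟩
  have hH := isPancyclic_of_iso e hG
  obtain ⟨N, p, C, h, hC, hCN⟩ := exists_isChordList hring (exists_isChord hV hH)
  rw [show G.edgeSet.ncard = H.edgeSet.ncard from Nat.card_congr e.mapEdgeSet,
    h.ncard_edgeSet hC hV.le]
  intro hk
  obtain rfl := Nat.add_left_cancel hk
  exact (h.lt_of_excludes hC hCN hV.le hH hexcl).not_ge hn₀

theorem card_le_ncard_edgeSet {V : Type*} [Fintype V] {G : SimpleGraph V}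
    (hV : 3 ≤ Fintype.card V) (hG : IsPancyclic G) : Fintype.card V ≤ G.edgeSet.ncard := by
  classical
  obtain ⟨v, w, hw, hlength⟩ := hG _ hV le_rfl
  rw [← hlength, ← w.length_edges, ← List.toFinset_card_of_nodup hw.edges_nodup,
    ← Set.ncard_coe_finset]
  exact Set.ncard_le_ncard fun e he => w.edges_subset_edgeSet (List.mem_toFinset.1 he)

/-! ### Graphs with few chords -/

section Construction

/-- The graph on `0, 1, …, n - 1` that consists of the ring `0, 1, …, n - 1, 0` and the chords
`L`. -/
def chordGraph (n : ℕ) (L : List (ℕ × ℕ)) : SimpleGraph (Fin n) :=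
  SimpleGraph.fromRel fun u v => (v : ℕ) = ((u : ℕ) + 1) % n ∨ ((u : ℕ), (v : ℕ)) ∈ L

instance (n : ℕ) (L : List (ℕ × ℕ)) : DecidableRel (chordGraph n L).Adj :=
  inferInstanceAs (DecidableRel (SimpleGraph.fromRel _).Adj)

/-- The neighbours of `u` in `chordGraph n L`. -/
def neighbours (n : ℕ) (L : List (ℕ × ℕ)) (u : ℕ) : List ℕ :=
  Nat.mod (Nat.succ u) n :: Nat.mod (Nat.add u (Nat.pred n)) n :: L.flatMap fun c =>
    bif Nat.beq c.1 u then [c.2] else bif Nat.beq c.2 u then [c.1] else []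

/-- The set of the lengths, encoded in binary, of the paths of at most `fuel` edges from `u` to `s`
that avoid the set `vis` after their start. Each path ends on its first return to `s`, so that
`s = u` gives the lengths of cycles and the closed walks of length 2. -/
def lengths (nb : ℕ → List ℕ) (s : ℕ) : ℕ → ℕ → ℕ → ℕ
  | 0, _, _ => 0
  | fuel + 1, vis, u => (nb u).foldr (fun w acc => Nat.lor
      (bif hasDigit vis w then 0 else bif Nat.beq w s then 2
        else Nat.mul 2 (lengths nb s fuel (Nat.lor vis (Nat.pow 2 w)) w)) acc) 0

/-- Whether the search finds cycles of all the lengths from `3` to `n` in `chordGraph n L`, looking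
for cycles through the vertices `starts` only. -/
def findsCycles (n : ℕ) (L : List (ℕ × ℕ)) (starts : List ℕ) : Bool :=
  force (starts.foldr (fun s acc => Nat.lor (lengths (neighbours n L) s n 0 s) acc) 0) fun t =>
    (List.range' 3 (n - 2)).all (hasDigit t)

theorem hasDigit_foldr_lor {α : Type*} (l : List α) (f : α → ℕ) (x : ℕ) :
    hasDigit (l.foldr (fun a acc => Nat.lor (f a) acc) 0) x ↔ ∃ a ∈ l, hasDigit (f a) x := by
  induction l with
  | nil => simp [hasDigit_zero]
  | cons a l ih => rw [List.foldr_cons, hasDigit_lor, Bool.or_eq_true, ih, List.exists_mem_cons_iff]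

theorem hasDigit_two_mul_iff {s x : ℕ} :
    hasDigit (Nat.mul 2 s) x ↔ ∃ y, x = y + 1 ∧ hasDigit s y := by
  simp only [hasDigit_eq_testBit, Nat.mul_eq]
  cases x <;> simp [Nat.testBit_succ]

theorem exists_walk_of_hasDigit_lengths {n : ℕ} {G : SimpleGraph (Fin n)} {nb : ℕ → List ℕ}
    (hnb : ∀ u : Fin n, ∀ w ∈ nb u, ∃ h : w < n, G.Adj u ⟨w, h⟩) {s u : Fin n}
    {fuel vis ℓ : ℕ} (h : hasDigit (lengths nb s fuel vis u) ℓ) :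
    ∃ p : G.Walk u s, p.length = ℓ ∧ p.support.tail.Nodup ∧
      ∀ x ∈ p.support.tail, hasDigit vis x = false := by
  induction fuel generalizing u vis ℓ with
  | zero => simp [lengths, hasDigit_zero] at h
  | succ fuel ih =>
    obtain ⟨w, hw, hstep⟩ := (hasDigit_foldr_lor _ _ _).1 h
    obtain ⟨hwn, hadj⟩ := hnb u w hw
    cases hvis : hasDigit vis w
    · rw [hvis, cond_false] at hstep
      cases hs : Nat.beq w s
      · rw [hs, cond_false, hasDigit_two_mul_iff] at hstep
        obtain ⟨ℓ, rfl, hrest⟩ := hstep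
        obtain ⟨p, hlength, hnodup, havoid⟩ := ih (u := ⟨w, hwn⟩) hrest
        simp only [hasDigit_lor, hasDigit_two_pow, Bool.or_eq_false_iff,
          decide_eq_false_iff_not] at havoid
        refine ⟨.cons hadj p, by rw [SimpleGraph.Walk.length_cons, hlength], ?_, ?_⟩
        · rw [SimpleGraph.Walk.support_cons, List.tail_cons, ← p.cons_tail_support]
          exact List.nodup_cons.2 ⟨fun hmem => (havoid _ hmem).2 rfl, hnodup⟩
        · rw [SimpleGraph.Walk.support_cons, List.tail_cons, ← p.cons_tail_support]
          exact List.forall_mem_cons.2 ⟨hvis, fun x hx => (havoid x hx).1⟩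
      · obtain rfl : s = ⟨w, hwn⟩ := Fin.ext (Nat.eq_of_beq_eq_true hs).symm
        rw [hs, cond_true, show 2 = Nat.pow 2 1 from rfl, hasDigit_two_pow,
          decide_eq_true_iff] at hstep
        exact ⟨hadj.toWalk, hstep, by simp, by simpa using hvis⟩
    · simp [hvis, hasDigit_zero] at hstep

theorem exists_isCycle_of_hasDigit_lengths {n : ℕ} {G : SimpleGraph (Fin n)} {nb : ℕ → List ℕ}
    (hnb : ∀ u : Fin n, ∀ w ∈ nb u, ∃ h : w < n, G.Adj u ⟨w, h⟩) {s : Fin n}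
    {fuel ℓ : ℕ} (hℓ : 3 ≤ ℓ) (h : hasDigit (lengths nb s fuel 0 s) ℓ) :
    ∃ p : G.Walk s s, p.IsCycle ∧ p.length = ℓ := by
  obtain ⟨p, rfl, hnodup, -⟩ := exists_walk_of_hasDigit_lengths hnb h
  have hp : ¬p.Nil := fun hnil => by
    rw [SimpleGraph.Walk.length_eq_zero_iff.2 hnil] at hℓ
    omega
  refine ⟨p, SimpleGraph.Walk.isCycle_iff_isPath_tail_and_le_length.2 ⟨?_, hℓ⟩, rfl⟩
  rwa [SimpleGraph.Walk.isPath_def, SimpleGraph.Walk.support_tail_of_not_nil _ hp]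

theorem chordGraph_adj_of_mem_neighbours {n : ℕ} {L : List (ℕ × ℕ)} (hn : 2 ≤ n)
    (hL : ∀ c ∈ L, c.1 < n ∧ c.2 < n ∧ c.1 ≠ c.2) (u : Fin n) {w : ℕ}
    (hw : w ∈ neighbours n L u) : ∃ h : w < n, (chordGraph n L).Adj u ⟨w, h⟩ := by
  have hu := u.isLt
  have hsucc {a : ℕ} (ha : a < n) : a ≠ (a + 1) % n := by
    obtain hlt | rfl := Nat.lt_or_eq_of_le (Nat.succ_le_of_lt ha)
    · rw [Nat.mod_eq_of_lt hlt]
      omega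
    · rw [Nat.mod_self]
      omega
  simp only [neighbours, List.mem_cons, List.mem_flatMap] at hw
  obtain rfl | rfl | ⟨c, hc, hw⟩ := hw
  · exact ⟨Nat.mod_lt _ (by omega), Fin.ne_of_val_ne (hsucc hu), .inl (.inl rfl)⟩
  · have hpred : (u : ℕ) = ((u + (n - 1)) % n + 1) % n := by
      rw [Nat.mod_add_mod, Nat.add_assoc, Nat.sub_add_cancel (by omega), Nat.add_mod_right,
        Nat.mod_eq_of_lt hu]
    have hlt : (u + (n - 1)) % n < n := Nat.mod_lt _ (by omega)
    exact ⟨hlt, Fin.ne_of_val_ne fun heq => hsucc hlt (heq.symm.trans hpred), .inr (.inl hpred)⟩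
  · obtain ⟨h₁, h₂, hne⟩ := hL c hc
    cases hu₁ : Nat.beq c.1 u
    · cases hu₂ : Nat.beq c.2 u
      · simp [hu₁, hu₂] at hw
      · obtain rfl : w = c.1 := by simpa [hu₁, hu₂] using hw
        have hu₂ := Nat.eq_of_beq_eq_true hu₂
        exact ⟨h₁, Fin.ne_of_val_ne (hu₂ ▸ hne.symm), .inr (.inr (hu₂ ▸ hc))⟩
    · obtain rfl : w = c.2 := by simpa [hu₁] using hw
      have hu₁ := Nat.eq_of_beq_eq_true hu₁
      exact ⟨h₂, Fin.ne_of_val_ne (hu₁ ▸ hne), .inl (.inr (hu₁ ▸ hc))⟩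

theorem isPancyclic_chordGraph {n : ℕ} {L : List (ℕ × ℕ)} {starts : List ℕ}
    (hL : ∀ c ∈ L, c.1 < n ∧ c.2 < n ∧ c.1 ≠ c.2) (hstarts : ∀ s ∈ starts, s < n)
    (h : findsCycles n L starts) : IsPancyclic (chordGraph n L) := by
  intro ℓ hℓ hcard
  rw [Fintype.card_fin] at hcard
  rw [findsCycles, force_eq] at h
  have hdigit := List.all_eq_true.1 h ℓ (by rw [List.mem_range'_1]; omega)
  obtain ⟨s, hs, hdigit⟩ := (hasDigit_foldr_lor _ _ _).1 hdigit
  exact ⟨_, exists_isCycle_of_hasDigit_lengths (s := ⟨s, hstarts s hs⟩)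
    (chordGraph_adj_of_mem_neighbours (by omega) hL) hℓ hdigit⟩

/-- A decidable condition which ensures that `chordGraph n L` is pancyclic and has `n + k` edges:
cycles of all lengths pass through the vertices `starts`, and the sum of the degrees is right. -/
def Certifies (n k : ℕ) (L : List (ℕ × ℕ)) (starts : List ℕ) : Prop :=
  (∀ c ∈ L, c.1 < n ∧ c.2 < n ∧ c.1 ≠ c.2) ∧ (∀ s ∈ starts, s < n) ∧ findsCycles n L starts ∧
    ∑ u, (chordGraph n L).degree u = 2 * (n + k)

instance (n k : ℕ) (L : List (ℕ × ℕ)) (starts : List ℕ) : Decidable (Certifies n k L starts) :=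
  inferInstanceAs (Decidable (_ ∧ _ ∧ _ ∧ _))

theorem Certifies.isPancyclic_and_ncard_edgeSet {n k : ℕ} {L : List (ℕ × ℕ)} {starts : List ℕ}
    (h : Certifies n k L starts) :
    IsPancyclic (chordGraph n L) ∧ (chordGraph n L).edgeSet.ncard = n + k := by
  obtain ⟨hL, hstarts, hcycles, hdegree⟩ := h
  refine ⟨isPancyclic_chordGraph hL hstarts hcycles, ?_⟩
  rw [SimpleGraph.sum_degrees_eq_twice_card_edges] at hdegree
  rw [← SimpleGraph.coe_edgeFinset, Set.ncard_coe_finset]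
  exact Nat.eq_of_mul_eq_mul_left two_pos hdegree

end Construction

/-! ### The exact values -/

/-- The excess of the least number of edges over the number `n` of vertices, for `3 ≤ n ≤ 37`. -/
def excess (n : ℕ) : ℕ :=
  if n ≤ 3 then 0 else if n ≤ 5 then 1 else if n ≤ 8 then 2 else if n ≤ 14 then 3
    else if n ≤ 24 then 4 else 5

theorem excludes_zero : excludes 0 4 := by decide +kernel

theorem excludes_one : excludes 1 6 := by decide +kernel

theorem excludes_two : excludes 2 9 := by decide +kernel

theorem excludes_three : excludes 3 15 := by decide +kernel

theorem excludes_four : excludes 4 25 := by decide +kernel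

theorem card_add_excess_le_ncard_edgeSet {V : Type*} [Fintype V] {G : SimpleGraph V}
    (hV : 3 ≤ Fintype.card V) (hG : IsPancyclic G) :
    Fintype.card V + excess (Fintype.card V) ≤ G.edgeSet.ncard := by
  have hle := card_le_ncard_edgeSet hV hG
  have hne {k n₀ : ℕ} (hexcl : excludes k n₀) (hn₀ : 3 < n₀) (hcard : n₀ ≤ Fintype.card V) :=
    ncard_edgeSet_ne_of_excludes (hn₀.trans_le hcard) hG hexcl hcard
  have h₀ := hne excludes_zero (by norm_num)
  have h₁ := hne excludes_one (by norm_num)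
  have h₂ := hne excludes_two (by norm_num)
  have h₃ := hne excludes_three (by norm_num)
  have h₄ := hne excludes_four (by norm_num)
  grind [excess]

theorem certifies_zero : Certifies 3 0 [] [0] := by decide +kernel

theorem certifies_one : ∀ n ∈ List.range' 4 2, Certifies n 1 [(0, 2)] [0] := by decide +kernel

theorem certifies_two : ∀ n ∈ List.range' 6 3, Certifies n 2 [(0, 2), (1, 4)] [1] := by
  decide +kernel

theorem certifies_three : ∀ n ∈ List.range' 9 6, Certifies n 3 [(0, 2), (0, 4), (1, 7)] [0] := by
  decide +kernel

theorem certifies_four :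
    ∀ n ∈ List.range' 15 10, Certifies n 4 [(0, 2), (1, 7), (2, 5), (3, n - 6)] [0, 2] := by
  decide +kernel

theorem certifies_five : ∀ n ∈ List.range' 21 17,
    Certifies n 5 [(0, 2), (1, 7), (3, 6), (4, 12), (8, 21 % n)] [0, 3, 8] := by
  decide +kernel

theorem exists_certifies_excess {n : ℕ} (h₃ : 3 ≤ n) (h₃₇ : n ≤ 37) :
    ∃ L starts, Certifies n (excess n) L starts := by
  rw [excess]
  split_ifs with h₁ h₂ h₃ h₄ h₅
  · obtain rfl : n = 3 := by omega
    exact ⟨_, _, certifies_zero⟩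
  · exact ⟨_, _, certifies_one n (by rw [List.mem_range'_1]; omega)⟩
  · exact ⟨_, _, certifies_two n (by rw [List.mem_range'_1]; omega)⟩
  · exact ⟨_, _, certifies_three n (by rw [List.mem_range'_1]; omega)⟩
  · exact ⟨_, _, certifies_four n (by rw [List.mem_range'_1]; omega)⟩
  · exact ⟨_, _, certifies_five n (by rw [List.mem_range'_1]; omega)⟩

theorem minPancyclicEdges_eq {n : ℕ} (h₃ : 3 ≤ n) (h₃₇ : n ≤ 37) :
    minPancyclicEdges n = n + excess n := by
  obtain ⟨L, starts, h⟩ := exists_certifies_excess h₃ h₃₇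
  have hmin : IsLeast {e : ℕ | ∃ G : SimpleGraph (Fin n), IsPancyclic G ∧ G.edgeSet.ncard = e}
      (n + excess n) := by
    refine ⟨⟨_, h.isPancyclic_and_ncard_edgeSet⟩, ?_⟩
    rintro _ ⟨G, hG, rfl⟩
    simpa only [Fintype.card_fin] using
      card_add_excess_le_ncard_edgeSet (h₃.trans_eq (Fintype.card_fin n).symm) hG
  exact hmin.csInf_eq

theorem fiveChordGraph_isPancyclic_and_ncard_edgeSet {n : ℕ} (h₂₁ : 21 ≤ n) (h₃₇ : n ≤ 37) :
    IsPancyclic (fiveChordGraph n) ∧ (fiveChordGraph n).edgeSet.ncard = n + 5 :=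
  (certifies_five n (by rw [List.mem_range'_1]; omega)).isPancyclic_and_ncard_edgeSet

end Pancyclic

theorem mainTheorem1 :
    (minPancyclicEdges 3 = 3 ∧
      (∀ n : ℕ, 4 ≤ n → n ≤ 5 → minPancyclicEdges n = n + 1) ∧
      (∀ n : ℕ, 6 ≤ n → n ≤ 8 → minPancyclicEdges n = n + 2) ∧
      (∀ n : ℕ, 9 ≤ n → n ≤ 14 → minPancyclicEdges n = n + 3) ∧
      (∀ n : ℕ, 15 ≤ n → n ≤ 24 → minPancyclicEdges n = n + 4) ∧
      (∀ n : ℕ, 25 ≤ n → n ≤ 37 → minPancyclicEdges n = n + 5)) ∧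
    (∀ n : ℕ, 21 ≤ n → n ≤ 37 →
      IsPancyclic (fiveChordGraph n) ∧ (fiveChordGraph n).edgeSet.ncard = n + 5) := by
  have hmin {n k : ℕ} (h₃ : 3 ≤ n) (h₃₇ : n ≤ 37) (hk : Pancyclic.excess n = k) :
      minPancyclicEdges n = n + k := hk ▸ Pancyclic.minPancyclicEdges_eq h₃ h₃₇
  refine ⟨⟨hmin le_rfl (by omega) rfl, ?_, ?_, ?_, ?_, ?_⟩,
    fun n => Pancyclic.fiveChordGraph_isPancyclic_and_ncard_edgeSet⟩
  all_goals exact fun n hle hge => hmin (by omega) (by omega) (by grind [Pancyclic.excess])
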